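/- Let $n\ge 0$, let $\Omega\subset\mathbb R^{n+1}$ be open, and let $$Lu=\sum_{i,j}h_{ij}\,\partial_i\partial_j u+\sum_j b_j\,\partial_j u+c\,u ,$$ where $h=(h_{ij})$ is a symmetric matrix function of signature $(n,1)$ on $\Omega$ with $h_{ij}\in C^1(\Omega)$ and $b_j,c\in C(\Omega)$. For functions $\varphi,\psi$ write $h(d\varphi,d\psi)=\sum_{i,j}h_{ij}\,\partial_i\varphi\,\partial_j\psi$. A level surface of $\varphi$ is spacelike if $h(d\varphi,d\varphi)<0$ on it. Let $O\subset\Omega$ be bounded by an initial and a final spacelike surface and swept out by spacelike surfaces. Precisely: $\overline O$ is compact and contained in $\Omega$; there are $\varphi_i,\varphi_e,t\in C^2(\Omega)$ with $O=\{x\in\Omega:\varphi_i(x)>0,\ \varphi_e(x)<0\}$; the surfaces $\Sigma_i=\overline O\cap\{\varphi_i=0\}$, $\Sigma_e=\overline O\cap\{\varphi_e=0\}$ and $\Sigma_e(s)=\overline O\cap\{t=s\}$, $s\in[s_0,s_1]$, are spacelike; $\overline O=\bigcup_{s\in[s_0,s_1]}\Sigma_e(s)$; and $\varphi_i$, $\varphi_e$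 increase to the future determined by $t$, i.e. $h(d\varphi_i,dt)<0$ on $\Sigma_i$ and $h(d\varphi_e,dt)<0$ on $\Sigma_e$. Put $$O(s)=\overline O\cap\{t\le s\},\qquad \Sigma_i^b(s)=\Sigma_i\cap\{t\le s\}.$$ Let $dV=\rho\,dx$ and $dS=\sigma\,d\mathcal H^n$, where $dx$ is Lebesgue measure, $\mathcal H^n$ is Euclidean surface measure, and $\rho$ on $\Omega$ and $\sigma$ on $\Sigma_i$ are any continuous positive densities (for example $\rho=\sigma=1$, or the densities of the volume and area elements of the Lorentz metric $h^{-1}$). Then there is a constant $C\ge 0$, depending only on these data (on $\Omega$, $L$, $O$, $\varphi_i,\varphi_e,t,s_0,s_1,\rho,\sigma$), with the following property. Let $u\in C^2(\Omega)$ solve the Cauchy problem $$Lu=f\ \text{ on } O,\qquad u=g,\quad du=\omega\ \text{ on }\Sigma_i,$$ with functions $f,g$ and a 1-form $\omega$. Let $p$ be a polynomial in $n+1$ variables interpolating this problem on finite (possibly empty) sets $\Theta\subset O$ and $\Theta_b\subset\Sigma_i$, i.e. $Lp=f$ on $\Theta$, and $p=g$, $dp=\omega$ on $\Theta_b$. Let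 $\Delta f,\Delta g,\Delta\omega$ be the residuals: $$L(u-p)=\Delta f\ \text{ on } O,\qquad u-p=\Delta g,\quad d(u-p)=\Delta\omega\ \text{ on }\Sigma_i .$$ Then for all $s\in[s_0,s_1]$ $$\int_{O(s)}|u-p|^2\,dV\le\int_{\Sigma_i^b(s)}|\Delta g|^2\,dS+C(s-s_0)\int_{\Sigma_i}\bigl(|\Delta g|^2+|\Delta\omega|^2\bigr)\,dS+C\int_{O(s)}|\Delta f|^2\,dV ,$$ where $|\Delta\omega|$ is the Euclidean norm of the 1-form. -/

import Mathlib

open scoped MeasureTheory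

/-- The `i`-th partial derivative of a function on Euclidean space. -/
noncomputable def partialDeriv {d : ℕ} (i : Fin d) (u : EuclideanSpace ℝ (Fin d) → ℝ)
    (x : EuclideanSpace ℝ (Fin d)) : ℝ :=
  fderiv ℝ u x (EuclideanSpace.single i 1)

/-- The second-order linear operator
`L u = ∑ i j, h i j * ∂ᵢ ∂ⱼ u + ∑ j, b j * ∂ⱼ u + c * u`. -/
noncomputable def secondOrderOp {d : ℕ}
    (h : EuclideanSpace ℝ (Fin d) → Matrix (Fin d) (Fin d) ℝ)
    (b : EuclideanSpace ℝ (Fin d) → Fin d → ℝ) (c : EuclideanSpace ℝ (Fin d) → ℝ)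
    (u : EuclideanSpace ℝ (Fin d) → ℝ) (x : EuclideanSpace ℝ (Fin d)) : ℝ :=
  ∑ i, ∑ j, h x i j * partialDeriv i (partialDeriv j u) x
    + ∑ j, b x j * partialDeriv j u x + c x * u x

/-- A real symmetric matrix of signature `(n, 1)`: the maximal dimension of a subspace on which
its quadratic form is positive (negative) definite is `n` (is `1`). -/
def HasLorentzSignature {n : ℕ} (A : Matrix (Fin (n + 1)) (Fin (n + 1)) ℝ) : Prop :=
  A.IsSymm ∧ sigPos A.toQuadraticForm' = n ∧
    sigNeg A.toQuadraticForm' = 1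

/-- The product `h(dφ, dψ) = ∑ i j, h i j * ∂ᵢ φ * ∂ⱼ ψ` of two differentials. -/
noncomputable def differentialProduct {d : ℕ}
    (h : EuclideanSpace ℝ (Fin d) → Matrix (Fin d) (Fin d) ℝ)
    (φ ψ : EuclideanSpace ℝ (Fin d) → ℝ) (x : EuclideanSpace ℝ (Fin d)) : ℝ :=
  ∑ i, ∑ j, h x i j * partialDeriv i φ x * partialDeriv j ψ x

/-- The part in `closure O` of the level surface `{φ = r}`. -/
def levelSurface {d : ℕ} (O : Set (EuclideanSpace ℝ (Fin d)))
    (φ : EuclideanSpace ℝ (Fin d) → ℝ) (r : ℝ) : Set (EuclideanSpace ℝ (Fin d)) :=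
  {x ∈ closure O | φ x = r}

/-- The part in `closure O` of the sublevel set `{t ≤ s}`. -/
def sweptRegion {d : ℕ} (O : Set (EuclideanSpace ℝ (Fin d)))
    (t : EuclideanSpace ℝ (Fin d) → ℝ) (s : ℝ) : Set (EuclideanSpace ℝ (Fin d)) :=
  {x ∈ closure O | t x ≤ s}

/-- A surface `S` in the zero set of `φ` is spacelike, with `φ` increasing to the future, as
determined by the time function `t`: the conormal `dφ` is timelike (`h(dφ, dφ) < 0`, so in
particular `dφ ≠ 0`) and lies in the same half of the light cone as `dt`. -/
def IsSpacelikeFuture {d : ℕ}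
    (h : EuclideanSpace ℝ (Fin d) → Matrix (Fin d) (Fin d) ℝ)
    (t φ : EuclideanSpace ℝ (Fin d) → ℝ) (S : Set (EuclideanSpace ℝ (Fin d))) : Prop :=
  ∀ x ∈ S, differentialProduct h φ φ x < 0 ∧ differentialProduct h φ t x < 0

/-- `O` is a relatively compact part of `Ω`, bounded by the initial spacelike surface
`Σᵢ = {φᵢ = 0}` in its past and the final spacelike surface `Σₑ = {φₑ = 0}` in its future, and
swept out by the spacelike surfaces `Σₑ(s) = {t = s}`, `s₀ ≤ s ≤ s₁` (all these surfaces being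
taken inside `closure O`). -/
structure IsSpacelikeSweptRegion {d : ℕ}
    (h : EuclideanSpace ℝ (Fin d) → Matrix (Fin d) (Fin d) ℝ)
    (Ω O : Set (EuclideanSpace ℝ (Fin d)))
    (φᵢ φₑ t : EuclideanSpace ℝ (Fin d) → ℝ) (s₀ s₁ : ℝ) : Prop where
  isCompact_closure : IsCompact (closure O)
  closure_subset : closure O ⊆ Ω
  contDiffOn_initial : ContDiffOn ℝ 2 φᵢ Ω
  contDiffOn_final : ContDiffOn ℝ 2 φₑ Ω
  contDiffOn_time : ContDiffOn ℝ 2 t Ω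
  between : O = {x ∈ Ω | 0 < φᵢ x ∧ φₑ x < 0}
  spacelike_initial : IsSpacelikeFuture h t φᵢ (levelSurface O φᵢ 0)
  spacelike_final : IsSpacelikeFuture h t φₑ (levelSurface O φₑ 0)
  spacelike_leaves : ∀ s ∈ Set.Icc s₀ s₁, IsSpacelikeFuture h t t (levelSurface O t s)
  swept : closure O = ⋃ s ∈ Set.Icc s₀ s₁, levelSurface O t s

/-- The function defined by a real polynomial in `d` variables. -/
noncomputable def polyFun {d : ℕ} (p : MvPolynomial (Fin d) ℝ)
    (x : EuclideanSpace ℝ (Fin d)) : ℝ :=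
  MvPolynomial.eval (fun i => x i) p

/-- `u` solves `L u = f` on `O` with Cauchy data `u = g` and `du = ω` on the surface `S`. -/
structure SolvesCauchyProblem {d : ℕ}
    (h : EuclideanSpace ℝ (Fin d) → Matrix (Fin d) (Fin d) ℝ)
    (b : EuclideanSpace ℝ (Fin d) → Fin d → ℝ) (c : EuclideanSpace ℝ (Fin d) → ℝ)
    (O S : Set (EuclideanSpace ℝ (Fin d)))
    (f g : EuclideanSpace ℝ (Fin d) → ℝ)
    (ω : EuclideanSpace ℝ (Fin d) → EuclideanSpace ℝ (Fin d) →L[ℝ] ℝ)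
    (u : EuclideanSpace ℝ (Fin d) → ℝ) : Prop where
  equation : ∀ x ∈ O, secondOrderOp h b c u x = f x
  value : ∀ x ∈ S, u x = g x
  differential : ∀ x ∈ S, fderiv ℝ u x = ω x

/-- `p` is an interpolation polynomial for the Cauchy problem `L u = f` on `O`, `u = g` and
`du = ω` on `S`: it satisfies the equation on the finite set `Θ` of points of `O`, and the initial
conditions on the finite set `Θb` of points of `S`. -/
structure IsInterpolationPolynomial {d : ℕ}
    (h : EuclideanSpace ℝ (Fin d) → Matrix (Fin d) (Fin d) ℝ)
    (b : EuclideanSpace ℝ (Fin d) → Fin d → ℝ) (c : EuclideanSpace ℝ (Fin d) → ℝ)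
    (O S : Set (EuclideanSpace ℝ (Fin d)))
    (f g : EuclideanSpace ℝ (Fin d) → ℝ)
    (ω : EuclideanSpace ℝ (Fin d) → EuclideanSpace ℝ (Fin d) →L[ℝ] ℝ)
    (Θ Θb : Finset (EuclideanSpace ℝ (Fin d))) (p : MvPolynomial (Fin d) ℝ) : Prop where
  interior_subset : ↑Θ ⊆ O
  initial_subset : ↑Θb ⊆ S
  equation : ∀ x ∈ Θ, secondOrderOp h b c (polyFun p) x = f x
  value : ∀ x ∈ Θb, polyFun p x = g x
  differential : ∀ x ∈ Θb, fderiv ℝ (polyFun p) x = ω x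

open Filter Topology MeasureTheory
open scoped ENNReal NNReal

/-- The bilinear form of a square matrix. -/
def matForm {d : ℕ} (A : Matrix (Fin d) (Fin d) ℝ) (p q : Fin d → ℝ) : ℝ :=
  ∑ i, ∑ j, A i j * p i * q j

section matForm
variable {d : ℕ} (A : Matrix (Fin d) (Fin d) ℝ) (p q r : Fin d → ℝ) (a : ℝ)

theorem matForm_add_left : matForm A (p + q) r = matForm A p r + matForm A q r := by
  simp only [matForm, Pi.add_apply, ← Finset.sum_add_distrib]
  refine Finset.sum_congr rfl fun i _ => Finset.sum_congr rfl fun j _ => by ring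

theorem matForm_add_right : matForm A p (q + r) = matForm A p q + matForm A p r := by
  simp only [matForm, Pi.add_apply, ← Finset.sum_add_distrib]
  refine Finset.sum_congr rfl fun i _ => Finset.sum_congr rfl fun j _ => by ring

theorem matForm_smul_left : matForm A (a • p) q = a * matForm A p q := by
  simp only [matForm, Pi.smul_apply, smul_eq_mul, Finset.mul_sum]
  refine Finset.sum_congr rfl fun i _ => Finset.sum_congr rfl fun j _ => by ring

theorem matForm_smul_right : matForm A p (a • q) = a * matForm A p q := by
  simp only [matForm, Pi.smul_apply, smul_eq_mul, Finset.mul_sum]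
  refine Finset.sum_congr rfl fun i _ => Finset.sum_congr rfl fun j _ => by ring

variable {A} in
theorem matForm_comm (hA : A.IsSymm) : matForm A p q = matForm A q p := by
  unfold matForm
  rw [Finset.sum_comm]
  refine Finset.sum_congr rfl fun i _ => Finset.sum_congr rfl fun j _ => ?_
  rw [hA.apply]; ring

theorem matForm_self : A.toQuadraticForm' p = matForm A p p := by
  simp only [Matrix.toQuadraticForm', LinearMap.BilinMap.toQuadraticMap_apply,
    Matrix.toLinearMap₂'_apply, matForm]
  refine Finset.sum_congr rfl fun i _ => Finset.sum_congr rfl fun j _ => by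
    simp only [smul_eq_mul]; ring

end matForm

/-- The orthogonal complement of a timelike vector is spacelike. -/
theorem matForm_pos_of_orthogonal {n : ℕ} {A : Matrix (Fin (n + 1)) (Fin (n + 1)) ℝ}
    (hA : HasLorentzSignature A) {p z : Fin (n + 1) → ℝ} (hp : matForm A p p < 0)
    (hpz : matForm A p z = 0) (hz : z ≠ 0) : 0 < matForm A z z := by
  obtain ⟨hsymm, hpos, -⟩ := hA
  by_contra! hzz
  have hzp : matForm A z p = 0 := by rw [matForm_comm _ _ hsymm, hpz]
  have hli : LinearIndependent ℝ ![p, z] := by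
    rw [LinearIndependent.pair_iff]
    intro a b hab
    have h1 : matForm A p (a • p + b • z) = 0 := by
      rw [hab]; simp [matForm]
    rw [matForm_add_right, matForm_smul_right, matForm_smul_right, hpz] at h1
    have ha : a = 0 := by
      rcases mul_eq_zero.1 (by simpa using h1 : a * matForm A p p = 0) with h | h
      · exact h
      · exact absurd h hp.ne
    refine ⟨ha, ?_⟩
    simpa [ha, hz] using hab
  have hfr : Module.finrank ℝ (Submodule.span ℝ (Set.range ![p, z])) = 2 := by
    simpa using finrank_span_eq_card hli
  have := QuadraticForm.sigPos_add_finrank_le_of_nonpos (Q := A.toQuadraticForm')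
    (V := Submodule.span ℝ (Set.range ![p, z])) (by
      rintro x hx
      simp only [Matrix.range_cons, Matrix.range_empty, Set.union_empty, Set.singleton_union,
        Submodule.mem_span_pair] at hx
      obtain ⟨a, b, rfl⟩ := hx
      rw [matForm_self]
      simp only [matForm_add_right, matForm_add_left, matForm_smul_right, matForm_smul_left, hpz,
        hzp]
      nlinarith [sq_nonneg a, sq_nonneg b])
  rw [hpos, hfr] at this
  simp at this

/-- The dominant energy condition: the energy flux of a nonzero covector `v` with respect to the
timelike covectors `p`, `q` in the same half of the light cone is positive. -/
theorem energyFlux_pos {n : ℕ} {A : Matrix (Fin (n + 1)) (Fin (n + 1)) ℝ}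
    (hA : HasLorentzSignature A) {p q v : Fin (n + 1) → ℝ} (hp : matForm A p p < 0)
    (hq : matForm A q q < 0) (hpq : matForm A q p < 0) (hv : v ≠ 0) :
    0 < 2 * matForm A p v * matForm A q v - matForm A q p * matForm A v v := by
  have hs := hA.1
  have key : ∀ x : Fin (n + 1) → ℝ, ∃ (a : ℝ) (z : Fin (n + 1) → ℝ),
      x = a • p + z ∧ matForm A p z = 0 := by
    intro x
    refine ⟨matForm A p x / matForm A p p, x - (matForm A p x / matForm A p p) • p, by simp, ?_⟩
    rw [sub_eq_add_neg, ← neg_smul, matForm_add_right, matForm_smul_right]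
    field_simp [hp.ne]
    ring
  obtain ⟨α, z, rfl, hz⟩ := key v
  obtain ⟨β, y, rfl, hy⟩ := key q
  have hz' : matForm A z p = 0 := by rw [matForm_comm _ _ hs, hz]
  have hy' : matForm A y p = 0 := by rw [matForm_comm _ _ hs, hy]
  simp only [matForm_add_right, matForm_add_left, matForm_smul_right, matForm_smul_left, hz, hy,
    hz', hy'] at hp hq hpq ⊢
  have hnn : ∀ x : Fin (n + 1) → ℝ, matForm A p x = 0 → 0 ≤ matForm A x x := by
    intro x hx
    by_cases h0 : x = 0
    · simp [h0, matForm]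
    · exact (matForm_pos_of_orthogonal hA hp hx h0).le
  set m := matForm A p p
  have hβ : 0 < β := by nlinarith
  have hpoly : ∀ r : ℝ, 0 ≤ matForm A z z * (r * r) + 2 * matForm A y z * r + matForm A y y := by
    intro r
    have := hnn (r • z + y) (by simp [matForm_add_right, matForm_smul_right, hz, hy])
    simp only [matForm_add_right, matForm_add_left, matForm_smul_right, matForm_smul_left,
      matForm_comm z y hs] at this
    nlinarith
  have hdisc := discrim_le_zero hpoly
  rw [discrim] at hdisc
  have hyy := hnn y hy
  set S := matForm A y z
  set Y := matForm A y y
  by_cases h0 : z = 0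
  · subst h0
    have hα : α ≠ 0 := by rintro rfl; simp at hv
    have hS : S = 0 := by simp [S, matForm]
    have hZ : matForm A (0 : Fin (n + 1) → ℝ) 0 = 0 := by simp [matForm]
    rw [hS, hZ]
    have : 0 < α ^ 2 * (m * m) * β := by have := mul_pos_of_neg_of_neg hp hp; positivity
    nlinarith
  · have hZ := matForm_pos_of_orthogonal hA hp hz h0
    set Z := matForm A z z
    have hgoal : 0 < -m * (-m * α ^ 2 * β - 2 * α * S + β * Z) := by
      apply mul_pos (by linarith)
      have h1 : S ^ 2 < -m * β ^ 2 * Z := by nlinarith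
      have h2 : 0 < (-m * β) * (-m * α ^ 2 * β - 2 * α * S + β * Z) := by
        nlinarith [sq_nonneg (-m * β * α - S)]
      exact pos_of_mul_pos_right h2 (by nlinarith)
    nlinarith

section Coordinates
variable {n : ℕ}

/-- Insert the coordinate `r` in position `i` into a vector of `ℝⁿ`. -/
def insertCoord (i : Fin (n + 1)) (r : ℝ) (y : EuclideanSpace ℝ (Fin n)) :
    EuclideanSpace ℝ (Fin (n + 1)) :=
  WithLp.toLp 2 (i.insertNth r y)

/-- Remove the `i`-th coordinate of a vector of `ℝⁿ⁺¹`. -/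
def removeCoord (i : Fin (n + 1)) (x : EuclideanSpace ℝ (Fin (n + 1))) :
    EuclideanSpace ℝ (Fin n) :=
  WithLp.toLp 2 (i.removeNth x)

theorem insertCoord_self (i : Fin (n + 1)) (r : ℝ) (y : EuclideanSpace ℝ (Fin n)) :
    insertCoord i r y i = r := by simp [insertCoord]

theorem removeCoord_insertCoord (i : Fin (n + 1)) (r : ℝ) (y : EuclideanSpace ℝ (Fin n)) :
    removeCoord i (insertCoord i r y) = y := by
  ext j; simp [insertCoord, removeCoord]

theorem dist_sq_eq_removeCoord (i : Fin (n + 1)) (x y : EuclideanSpace ℝ (Fin (n + 1))) :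
    dist x y ^ 2 = |x i - y i| ^ 2 + dist (removeCoord i x) (removeCoord i y) ^ 2 := by
  rw [EuclideanSpace.dist_eq, EuclideanSpace.dist_eq, Real.sq_sqrt (by positivity),
    Real.sq_sqrt (by positivity), Fin.sum_univ_succAbove _ i]
  simp [removeCoord, Fin.removeNth, Real.dist_eq]

theorem dist_eq_of_removeCoord_eq (i : Fin (n + 1)) {x y : EuclideanSpace ℝ (Fin (n + 1))}
    (h : removeCoord i x = removeCoord i y) : dist x y = |x i - y i| := by
  have := dist_sq_eq_removeCoord i x y
  rw [h, dist_self] at this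
  exact (pow_left_inj₀ dist_nonneg (abs_nonneg _) two_ne_zero).1 (by simpa using this)

theorem lipschitzWith_removeCoord (i : Fin (n + 1)) :
    LipschitzWith 1 (removeCoord i : EuclideanSpace ℝ (Fin (n + 1)) → _) := by
  refine LipschitzWith.of_dist_le_mul fun x y => ?_
  have := dist_sq_eq_removeCoord i x y
  rw [NNReal.coe_one, one_mul]
  exact (pow_le_pow_iff_left₀ dist_nonneg dist_nonneg two_ne_zero).1
    (by nlinarith [sq_nonneg |x i - y i|])

theorem measurePreserving_insertCoord (i : Fin (n + 1)) :
    MeasurePreserving (fun z : ℝ × EuclideanSpace ℝ (Fin n) => insertCoord i z.1 z.2) := by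
  have h1 : MeasurePreserving (Prod.map id (WithLp.ofLp) :
      ℝ × EuclideanSpace ℝ (Fin n) → ℝ × (Fin n → ℝ)) :=
    (MeasurePreserving.id volume).prod (PiLp.volume_preserving_ofLp (Fin n))
  have h2 := (volume_preserving_piFinSuccAbove (fun _ : Fin (n + 1) => ℝ) i).symm
  have h3 := PiLp.volume_preserving_toLp (Fin (n + 1))
  exact h3.comp (h2.comp h1)

theorem lintegral_eq_lintegral_insertCoord (i : Fin (n + 1))
    {F : EuclideanSpace ℝ (Fin (n + 1)) → ℝ≥0∞} (hF : Measurable F) :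
    ∫⁻ x, F x = ∫⁻ y, ∫⁻ r, F (insertCoord i r y) := by
  rw [← (measurePreserving_insertCoord i).lintegral_comp hF, Measure.volume_eq_prod]
  exact lintegral_prod_symm _ (hF.comp (measurePreserving_insertCoord i).measurable).aemeasurable

/-- The values of `φ` separate the points of `s` on lines parallel to the `i`-th axis, at least
as fast as `c` times the distance. -/
def LineExpanding (φ : EuclideanSpace ℝ (Fin (n + 1)) → ℝ) (i : Fin (n + 1)) (c : ℝ)
    (s : Set (EuclideanSpace ℝ (Fin (n + 1)))) : Prop :=
  ∀ x ∈ s, ∀ y ∈ s, removeCoord i x = removeCoord i y → c * |x i - y i| ≤ |φ x - φ y|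

theorem exists_lineExpanding {φ : EuclideanSpace ℝ (Fin (n + 1)) → ℝ}
    {x : EuclideanSpace ℝ (Fin (n + 1))}
    {φ' : EuclideanSpace ℝ (Fin (n + 1)) →L[ℝ] ℝ} (h : HasStrictFDerivAt φ φ' x)
    (hne : φ' ≠ 0) : ∃ i c, 0 < c ∧ ∃ s ∈ 𝓝 x, LineExpanding φ i c s := by
  obtain ⟨i, hi⟩ : ∃ i, φ' (EuclideanSpace.single i 1) ≠ 0 := by
    by_contra! h0
    apply hne
    ext v
    have := (EuclideanSpace.basisFun (Fin (n + 1)) ℝ).sum_repr v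
    rw [← this]
    simp [h0]
  set a := φ' (EuclideanSpace.single i 1)
  have ha : 0 < |a| := abs_pos.2 hi
  refine ⟨i, |a| / 2, by positivity, ?_⟩
  have h1 := h.isLittleO.def (half_pos ha)
  rw [nhds_prod_eq] at h1
  obtain ⟨s, hs, h2⟩ := (Filter.eventually_prod_self_iff
    (r := fun y z => ‖φ y - φ z - φ' (y - z)‖ ≤ |a| / 2 * ‖y - z‖)).1 h1
  refine ⟨s, hs, fun y hy z hz hyz => ?_⟩
  have h3 := h2 y hy z hz
  have h4 : y - z = (y i - z i) • EuclideanSpace.single i (1 : ℝ) := by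
    ext j
    rcases eq_or_ne j i with rfl | hj
    · simp
    · obtain ⟨j', rfl⟩ := Fin.exists_succAbove_eq hj
      have := congrArg (fun w : EuclideanSpace ℝ (Fin n) => w j') hyz
      simp only [removeCoord, Fin.removeNth] at this
      simp [this]
  rw [← dist_eq_norm y z, dist_eq_of_removeCoord_eq i hyz, h4, map_smul, Real.norm_eq_abs,
    smul_eq_mul] at h3
  have h5 := abs_sub_abs_le_abs_sub ((y i - z i) * a) ((φ y - φ z))
  rw [abs_mul, abs_sub_comm] at h5
  change _ ≤ |a| / 2 * |y i - z i| at h3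
  change |φ y - φ z - (y i - z i) * a| ≤ _ at h3
  rw [abs_sub_comm (z i)] at h5
  rw [abs_sub_comm (φ y - φ z)] at h3
  linarith

end Coordinates

section Shell
variable {n : ℕ}

/-- The points of `K` where `φ` is between `0` and `1 / k`. -/
def shell {E : Type*} (K : Set E) (φ : E → ℝ) (k : ℕ) : Set E :=
  {x ∈ K | 0 ≤ φ x ∧ k * φ x ≤ 1}

theorem isClosed_shell {E : Type*} [TopologicalSpace E] {K : Set E} (hK : IsClosed K) {φ : E → ℝ}
    (hφ : ContinuousOn φ K) (k : ℕ) : IsClosed (shell K φ k) :=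
  ContinuousOn.preimage_isClosed_of_isClosed (t := {r : ℝ | 0 ≤ r ∧ k * r ≤ 1}) hφ hK
    ((isClosed_le continuous_const continuous_id).inter
      (isClosed_le (continuous_const.mul continuous_id) continuous_const))

theorem lintegral_fiber_shell_le {K : Set (EuclideanSpace ℝ (Fin (n + 1)))}
    {φ : EuclideanSpace ℝ (Fin (n + 1)) → ℝ} {i : Fin (n + 1)} {c : ℝ} (hc : 0 < c)
    (hφ : LineExpanding φ i c K) {F : EuclideanSpace ℝ (Fin (n + 1)) → ℝ≥0} (k : ℕ)
    (y : EuclideanSpace ℝ (Fin n)) (a : ℝ≥0)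
    (ha : ∀ x ∈ shell K φ k, removeCoord i x = y → F x ≤ a) :
    ∫⁻ r, (shell K φ k).indicator (fun x => (k : ℝ≥0∞) * F x) (insertCoord i r y)
      ≤ ENNReal.ofReal c⁻¹ * a := by
  rcases Nat.eq_zero_or_pos k with rfl | hk
  · simp
  have hk' : (0 : ℝ) < k := Nat.cast_pos.2 hk
  calc ∫⁻ r, (shell K φ k).indicator (fun x => (k : ℝ≥0∞) * F x) (insertCoord i r y)
      ≤ ∫⁻ r, {r | insertCoord i r y ∈ shell K φ k}.indicator (fun _ => (k : ℝ≥0∞) * a) r := by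
        refine lintegral_mono fun r => ?_
        by_cases hr : insertCoord i r y ∈ shell K φ k
        · rw [Set.indicator_of_mem hr, Set.indicator_of_mem (by exact hr)]
          gcongr
          exact ha _ hr (removeCoord_insertCoord i r y)
        · rw [Set.indicator_of_notMem hr]
          exact zero_le
    _ ≤ (k : ℝ≥0∞) * a * volume {r | insertCoord i r y ∈ shell K φ k} :=
        lintegral_indicator_const_le _ _
    _ ≤ (k : ℝ≥0∞) * a * ENNReal.ofReal (c⁻¹ * (k : ℝ)⁻¹) := by
        gcongr
        refine (Real.volume_le_diam _).trans (Metric.ediam_le fun r hr r' hr' => ?_)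
        rw [edist_dist]
        refine ENNReal.ofReal_le_ofReal ?_
        have h1 := hφ _ hr.1 _ hr'.1 (by simp only [removeCoord_insertCoord])
        rw [insertCoord_self, insertCoord_self] at h1
        obtain ⟨-, h2, h3⟩ := hr
        obtain ⟨-, h4, h5⟩ := hr'
        rw [mul_comm, ← le_div_iff₀ hk'] at h3 h5
        have h6 : |φ (insertCoord i r y) - φ (insertCoord i r' y)| ≤ (k : ℝ)⁻¹ := by
          rw [abs_le]; constructor <;> simp only [one_div] at h3 h5 <;> linarith
        rw [Real.dist_eq, inv_mul_eq_div, le_div_iff₀ hc]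
        linarith
    _ = ENNReal.ofReal c⁻¹ * a := by
        rw [ENNReal.ofReal_mul (by positivity), ENNReal.ofReal_inv_of_pos hk',
          ENNReal.ofReal_natCast]
        have : (k : ℝ≥0∞) * (k : ℝ≥0∞)⁻¹ = 1 :=
          ENNReal.mul_inv_cancel (by simpa using hk.ne') (by simp)
        calc (k : ℝ≥0∞) * a * (ENNReal.ofReal c⁻¹ * (k : ℝ≥0∞)⁻¹)
            = ((k : ℝ≥0∞) * (k : ℝ≥0∞)⁻¹) * (ENNReal.ofReal c⁻¹ * a) := by ring
          _ = _ := by rw [this, one_mul]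

/-- Integration over a projection is dominated by integration with respect to surface measure. -/
theorem setLIntegral_removeCoord_image_le (i : Fin (n + 1))
    (Z : Set (EuclideanSpace ℝ (Fin (n + 1))))
    {G : EuclideanSpace ℝ (Fin n) → ℝ≥0∞} (hG : Measurable G) :
    ∫⁻ y in removeCoord i '' Z, G y ≤ ∫⁻ x in Z, G (removeCoord i x) ∂μHE[n] := by
  have hm : Measurable (removeCoord i : EuclideanSpace ℝ (Fin (n + 1)) → _) :=
    (lipschitzWith_removeCoord i).continuous.measurable
  rw [← lintegral_map hG hm]
  refine lintegral_mono' (Measure.le_iff.2 fun B hB => ?_) le_rfl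
  rw [Measure.restrict_apply hB, Measure.map_apply hm hB, Measure.restrict_apply (hm hB),
    ← EuclideanSpace.euclideanHausdorffMeasure_eq_volume]
  have : B ∩ removeCoord i '' Z ⊆ removeCoord i '' (removeCoord i ⁻¹' B ∩ Z) := by
    rintro _ ⟨hx, x, hxZ, rfl⟩
    exact ⟨x, ⟨hx, hxZ⟩, rfl⟩
  refine (measure_mono this).trans ?_
  have := (lipschitzWith_removeCoord i).hausdorffMeasure_image_le (d := n) (by positivity)
    (removeCoord i ⁻¹' B ∩ Z)
  simp only [Measure.euclideanHausdorffMeasure_def, Measure.smul_apply]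
  gcongr
  simpa using this

theorem measurable_indicator_of_continuousOn {X Y : Type*} [TopologicalSpace X] [MeasurableSpace X]
    [OpensMeasurableSpace X] [TopologicalSpace Y] [MeasurableSpace Y] [BorelSpace Y] [Zero Y]
    {s : Set X} (hs : MeasurableSet s) {f : X → Y} (hf : ContinuousOn f s) :
    Measurable (s.indicator f) := by
  classical
  rw [← Set.piecewise_eq_indicator]
  exact hf.measurable_piecewise continuousOn_const hs

theorem limsup_lintegral_shell_le_of_lineExpanding {K : Set (EuclideanSpace ℝ (Fin (n + 1)))}
    (hK : IsCompact K) {φ : EuclideanSpace ℝ (Fin (n + 1)) → ℝ} (hφc : ContinuousOn φ K)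
    {i : Fin (n + 1)} {c : ℝ} (hc : 0 < c) (hφ : LineExpanding φ i c K)
    {F : EuclideanSpace ℝ (Fin (n + 1)) → ℝ≥0} (hF : ContinuousOn F K) :
    limsup (fun k : ℕ => ∫⁻ x in shell K φ k, (k : ℝ≥0∞) * F x) atTop
      ≤ ENNReal.ofReal c⁻¹ * ∫⁻ x in {x ∈ K | φ x = 0}, F x ∂μHE[n] := by
  have hπ : Continuous (removeCoord i : EuclideanSpace ℝ (Fin (n + 1)) → _) :=
    (lipschitzWith_removeCoord i).continuous
  have hS : ∀ k, IsClosed (shell K φ k) := isClosed_shell hK.isClosed hφc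
  have hZ : IsCompact {x ∈ K | φ x = 0} :=
    hK.of_isClosed_subset (hφc.preimage_isClosed_of_isClosed hK.isClosed isClosed_singleton)
      (Set.sep_subset _ _)
  have hm : ∀ k : ℕ, Measurable ((shell K φ k).indicator (fun x => (k : ℝ≥0∞) * F x)) := by
    intro k
    have : Measurable ((shell K φ k).indicator F) :=
      measurable_indicator_of_continuousOn (hS k).measurableSet (hF.mono (Set.sep_subset _ _))
    convert (this.coe_nnreal_ennreal.const_mul (k : ℝ≥0∞)) using 2 with x
    by_cases hx : x ∈ shell K φ k <;> simp [hx]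
  set g : ℕ → EuclideanSpace ℝ (Fin n) → ℝ≥0∞ := fun k y =>
    ∫⁻ r, (shell K φ k).indicator (fun x => (k : ℝ≥0∞) * F x) (insertCoord i r y) with hg
  have hgm : ∀ k, Measurable (g k) := fun k =>
    ((hm k).comp (measurePreserving_insertCoord i).measurable).lintegral_prod_left'
  have hG : Measurable (fun y => limsup (fun k => g k y) atTop) := Measurable.limsup hgm
  have hint : ∀ k, ∫⁻ x in shell K φ k, (k : ℝ≥0∞) * F x = ∫⁻ y, g k y := by
    intro k
    rw [← lintegral_indicator (hS k).measurableSet, lintegral_eq_lintegral_insertCoord i (hm k)]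
  obtain ⟨B, hB⟩ := (hK.image_of_continuousOn hF).bddAbove
  have hdom : ∀ k, g k ≤ᵐ[volume]
      (removeCoord i '' K).indicator (fun _ => ENNReal.ofReal c⁻¹ * B) := by
    refine fun k => Eventually.of_forall fun y => ?_
    by_cases hy : y ∈ removeCoord i '' K
    · rw [Set.indicator_of_mem hy]
      exact lintegral_fiber_shell_le hc hφ k y B fun x hx _ => hB ⟨x, hx.1, rfl⟩
    · rw [Set.indicator_of_notMem hy]
      simpa using lintegral_fiber_shell_le hc hφ k y 0 fun x hx h => absurd ⟨x, hx.1, h⟩ hy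
  have hzero : ∀ x ∈ K, φ x = 0 →
      limsup (fun k => g k (removeCoord i x)) atTop ≤ ENNReal.ofReal c⁻¹ * F x := by
    intro x hxK hx0
    have hev : ∀ ε : ℝ≥0, 0 < ε →
        limsup (fun k => g k (removeCoord i x)) atTop ≤ ENNReal.ofReal c⁻¹ * (F x + ε : ℝ≥0) := by
      intro ε hε
      refine limsup_le_of_le (by isBoundedDefault) ?_
      have h1 : ∀ᶠ z in 𝓝[K] x, F z < F x + ε :=
        (hF x hxK).eventually (gt_mem_nhds (lt_add_of_pos_right _ hε))
      obtain ⟨δ, hδ, h2⟩ := Metric.mem_nhdsWithin_iff.1 h1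
      obtain ⟨k₀, hk₀⟩ := exists_nat_gt (1 / (c * δ))
      filter_upwards [eventually_ge_atTop k₀] with k hk
      refine lintegral_fiber_shell_le hc hφ k _ _ fun z hz hzx => ?_
      refine le_of_lt (h2 ⟨?_, hz.1⟩)
      rw [Metric.mem_ball, dist_eq_of_removeCoord_eq i hzx]
      have h3 := hφ z hz.1 x hxK hzx
      obtain ⟨-, h4, h5⟩ := hz
      rw [hx0, sub_zero, abs_of_nonneg h4] at h3
      have h6 : (1 / (c * δ)) < k := hk₀.trans_le (Nat.cast_le.2 hk)
      have hk0 : (0 : ℝ) < k := lt_trans (by positivity) h6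
      rw [div_lt_iff₀ (by positivity)] at h6
      by_contra! h7
      have h8 : c * δ ≤ φ z := (mul_le_mul_of_nonneg_left h7 hc.le).trans h3
      nlinarith [mul_le_mul_of_nonneg_left h8 hk0.le]
    have ht : Tendsto (fun ε : ℝ≥0 => ENNReal.ofReal c⁻¹ * ((F x + ε : ℝ≥0) : ℝ≥0∞))
        (𝓝[>] 0) (𝓝 (ENNReal.ofReal c⁻¹ * ((F x + 0 : ℝ≥0) : ℝ≥0∞))) := by
      refine Tendsto.mono_left (Continuous.tendsto ?_ 0) nhdsWithin_le_nhds
      exact (ENNReal.continuous_const_mul ENNReal.ofReal_ne_top).comp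
        (ENNReal.continuous_coe.comp (continuous_const.add continuous_id))
    rw [add_zero] at ht
    exact ge_of_tendsto ht (eventually_nhdsWithin_of_forall hev)
  have hnone : ∀ y ∉ removeCoord i '' {x ∈ K | φ x = 0}, limsup (fun k => g k y) atTop = 0 := by
    intro y hy
    have hc1 : IsCompact (K ∩ removeCoord i ⁻¹' {y}) :=
      hK.inter_right (isClosed_singleton.preimage hπ)
    have hc2 := (hc1.image_of_continuousOn (hφc.mono Set.inter_subset_left)).isClosed
    have h0 : (0 : ℝ) ∈ (φ '' (K ∩ removeCoord i ⁻¹' {y}))ᶜ := by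
      rintro ⟨x, hx, hx0⟩
      exact hy ⟨x, ⟨hx.1, hx0⟩, hx.2⟩
    obtain ⟨δ, hδ, h2⟩ := Metric.isOpen_iff.1 hc2.isOpen_compl 0 h0
    obtain ⟨k₀, hk₀⟩ := exists_nat_gt (1 / δ)
    refine le_antisymm (limsup_le_of_le (by isBoundedDefault) ?_) zero_le
    filter_upwards [eventually_ge_atTop k₀] with k hk
    have := lintegral_fiber_shell_le (F := F) hc hφ k y 0 fun z hz hzy => by
      exfalso
      refine h2 (a := φ z) ?_ ⟨z, ⟨hz.1, hzy⟩, rfl⟩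
      obtain ⟨-, h4, h5⟩ := hz
      rw [Metric.mem_ball, Real.dist_eq, sub_zero, abs_of_nonneg h4]
      have h6 : 1 / δ < k := hk₀.trans_le (Nat.cast_le.2 hk)
      have hk0 : (0 : ℝ) < k := lt_trans (by positivity) h6
      rw [div_lt_iff₀ hδ] at h6
      by_contra! h7
      nlinarith
    simpa using this
  simp only [hint]
  calc limsup (fun k => ∫⁻ y, g k y) atTop
      ≤ ∫⁻ y, limsup (fun k => g k y) atTop := by
        refine limsup_lintegral_le _ hgm hdom ?_
        rw [lintegral_indicator ((hK.image hπ).isClosed.measurableSet), setLIntegral_const]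
        exact ENNReal.mul_ne_top (ENNReal.mul_ne_top ENNReal.ofReal_ne_top ENNReal.coe_ne_top)
          (hK.image hπ).measure_lt_top.ne
    _ = ∫⁻ y in removeCoord i '' {x ∈ K | φ x = 0}, limsup (fun k => g k y) atTop := by
        rw [← lintegral_indicator ((hZ.image hπ).isClosed.measurableSet)]
        refine lintegral_congr fun y => ?_
        by_cases hy : y ∈ removeCoord i '' {x ∈ K | φ x = 0}
        · rw [Set.indicator_of_mem hy]
        · rw [Set.indicator_of_notMem hy, hnone y hy]
    _ ≤ ∫⁻ x in {x ∈ K | φ x = 0}, limsup (fun k => g k (removeCoord i x)) atTop ∂μHE[n] :=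
        setLIntegral_removeCoord_image_le i _ hG
    _ ≤ ∫⁻ x in {x ∈ K | φ x = 0}, ENNReal.ofReal c⁻¹ * F x ∂μHE[n] :=
        setLIntegral_mono' hZ.isClosed.measurableSet fun x hx => hzero x hx.1 hx.2
    _ = _ := lintegral_const_mul' _ _ ENNReal.ofReal_ne_top

theorem ennreal_limsup_add_le {ι : Type*} (l : Filter ι) (u v : ι → ℝ≥0∞) :
    limsup (u + v) l ≤ limsup u l + limsup v l := by
  refine ENNReal.le_of_forall_pos_le_add fun ε hε h => ?_
  have hε2 : (ε : ℝ≥0∞) / 2 ≠ 0 := by simpa using hε.ne'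
  rw [ENNReal.add_lt_top] at h
  refine limsup_le_of_le (by isBoundedDefault) ?_
  filter_upwards [eventually_lt_of_limsup_lt (ENNReal.lt_add_right h.1.ne hε2),
    eventually_lt_of_limsup_lt (ENNReal.lt_add_right h.2.ne hε2)] with x h1 h2
  refine (add_le_add h1.le h2.le).trans (le_of_eq ?_)
  rw [add_add_add_comm, ENNReal.add_halves]

/-- Thin one-sided neighbourhoods of a level surface, weighted by the inverse of their width, are
controlled by the surface measure. -/
theorem exists_limsup_lintegral_shell_le {K : Set (EuclideanSpace ℝ (Fin (n + 1)))}
    (hK : IsCompact K) {φ : EuclideanSpace ℝ (Fin (n + 1)) → ℝ}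
    (hφ : ∀ x ∈ K, ContDiffAt ℝ 1 φ x) (hne : ∀ x ∈ K, φ x = 0 → fderiv ℝ φ x ≠ 0) :
    ∃ C : ℝ≥0, ∀ F : EuclideanSpace ℝ (Fin (n + 1)) → ℝ≥0, ContinuousOn F K →
      limsup (fun k : ℕ => ∫⁻ x in shell K φ k, (k : ℝ≥0∞) * F x) atTop
        ≤ C * ∫⁻ x in {x ∈ K | φ x = 0}, F x ∂μHE[n] := by
  have hφc : ContinuousOn φ K := fun x hx => (hφ x hx).continuousAt.continuousWithinAt
  suffices H : ∃ C : ℝ≥0, ∀ F : EuclideanSpace ℝ (Fin (n + 1)) → ℝ≥0, ContinuousOn F K →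
      limsup (fun k : ℕ => ∫⁻ x in shell K φ k ∩ K, (k : ℝ≥0∞) * F x) atTop
        ≤ C * ∫⁻ x in {x ∈ K | φ x = 0}, F x ∂μHE[n] by
    have h : ∀ k, shell K φ k ∩ K = shell K φ k :=
      fun k => Set.inter_eq_left.2 (Set.sep_subset _ _)
    simpa only [h] using H
  refine hK.induction_on (p := fun s => ∃ C : ℝ≥0,
    ∀ F : EuclideanSpace ℝ (Fin (n + 1)) → ℝ≥0, ContinuousOn F K →
      limsup (fun k : ℕ => ∫⁻ x in shell K φ k ∩ s, (k : ℝ≥0∞) * F x) atTop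
        ≤ C * ∫⁻ x in {x ∈ K | φ x = 0}, F x ∂μHE[n]) ?_ ?_ ?_ ?_
  · exact ⟨0, fun F _ => by simp⟩
  · rintro s t hst ⟨C, hC⟩
    refine ⟨C, fun F hF => (limsup_le_limsup (Eventually.of_forall fun k => ?_)).trans (hC F hF)⟩
    exact lintegral_mono_set (Set.inter_subset_inter_right _ hst)
  · rintro s t ⟨C, hC⟩ ⟨D, hD⟩
    refine ⟨C + D, fun F hF => ?_⟩
    rw [ENNReal.coe_add, add_mul]
    refine le_trans ?_ (add_le_add (hC F hF) (hD F hF))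
    refine le_trans (limsup_le_limsup (Eventually.of_forall fun k => ?_))
      (ennreal_limsup_add_le _ _ _)
    simp only [Set.inter_union_distrib_left]
    exact lintegral_union_le _ _ _
  · intro x hx
    by_cases h0 : φ x = 0
    · obtain ⟨i, c, hc, s, hs, hexp⟩ :=
        exists_lineExpanding ((hφ x hx).hasStrictFDerivAt one_ne_zero) (hne x hx h0)
      obtain ⟨r, hr, hrs⟩ := Metric.nhds_basis_closedBall.mem_iff.1 hs
      have hK' : IsCompact (K ∩ Metric.closedBall x r) := hK.inter_right Metric.isClosed_closedBall
      refine ⟨_, inter_mem_nhdsWithin K (Metric.closedBall_mem_nhds x hr), (c⁻¹).toNNReal,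
        fun F hF => ?_⟩
      refine le_trans (le_of_eq ?_) ((limsup_lintegral_shell_le_of_lineExpanding hK'
        (hφc.mono Set.inter_subset_left) hc
        (fun y hy z hz => hexp y (hrs hy.2) z (hrs hz.2)) (hF.mono Set.inter_subset_left)).trans
        ?_)
      · congr! 4 with k
        ext y
        simp only [shell, Set.mem_inter_iff, Set.mem_ofPred_eq]
        tauto
      · gcongr ?_ * ?_
        · exact le_rfl
        · exact lintegral_mono_set fun y hy => ⟨hy.1.1, hy.2⟩
    · have h1 : ∀ᶠ y in 𝓝[K] x, |φ x| / 2 < |φ y| :=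
        (hφc x hx).abs.eventually (lt_mem_nhds (half_lt_self (abs_pos.2 h0)))
      refine ⟨_, h1, 0, fun F hF => limsup_le_of_le (by isBoundedDefault) ?_⟩
      obtain ⟨k₀, hk₀⟩ := exists_nat_gt (1 / (|φ x| / 2))
      filter_upwards [eventually_ge_atTop k₀] with k hk
      have : shell K φ k ∩ {y | |φ x| / 2 < |φ y|} = ∅ := by
        refine Set.eq_empty_of_forall_notMem fun y ⟨⟨_, h4, h5⟩, h3⟩ => ?_
        have hpos := abs_pos.2 h0
        have h6 : 1 / (|φ x| / 2) < k := hk₀.trans_le (Nat.cast_le.2 hk)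
        have hk0 : (0 : ℝ) < k := lt_trans (by positivity) h6
        rw [div_lt_iff₀ (by positivity)] at h6
        simp only [Set.mem_ofPred_eq, abs_of_nonneg h4] at h3
        nlinarith
      simp [this]

theorem volume_levelSet_eq_zero_of_lineExpanding {s : Set (EuclideanSpace ℝ (Fin (n + 1)))}
    {φ : EuclideanSpace ℝ (Fin (n + 1)) → ℝ} {i : Fin (n + 1)} {c : ℝ} (hc : 0 < c)
    (hφ : LineExpanding φ i c s) {r : ℝ} (hs : IsClosed s) (hφc : ContinuousOn φ s) :
    volume {x ∈ s | φ x = r} = 0 := by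
  have hm : MeasurableSet {x ∈ s | φ x = r} :=
    (hφc.preimage_isClosed_of_isClosed hs (isClosed_singleton (x := r))).measurableSet
  rw [← lintegral_indicator_one hm,
    lintegral_eq_lintegral_insertCoord i (measurable_one.indicator hm)]
  refine (lintegral_congr fun y => ?_).trans lintegral_zero
  refine (lintegral_indicator_one (hm.preimage
    ((measurePreserving_insertCoord i).measurable.comp measurable_prodMk_right))).trans ?_
  refine Set.Subsingleton.measure_zero (fun a ha b hb => ?_) _
  change insertCoord i a y ∈ {x ∈ s | φ x = r} at ha
  change insertCoord i b y ∈ {x ∈ s | φ x = r} at hb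
  have := hφ _ ha.1 _ hb.1 (by simp only [removeCoord_insertCoord])
  rw [insertCoord_self, insertCoord_self, ha.2, hb.2, sub_self, abs_zero] at this
  have h2 : |a - b| ≤ 0 := by
    by_contra! h
    nlinarith
  exact sub_eq_zero.1 (abs_nonpos_iff.1 h2)

theorem volume_levelSet_eq_zero {K : Set (EuclideanSpace ℝ (Fin (n + 1)))} (hK : IsClosed K)
    {φ : EuclideanSpace ℝ (Fin (n + 1)) → ℝ} {r : ℝ} (hφ : ∀ x ∈ K, ContDiffAt ℝ 1 φ x)
    (hne : ∀ x ∈ K, φ x = r → fderiv ℝ φ x ≠ 0) : volume {x ∈ K | φ x = r} = 0 := by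
  have hφc : ContinuousOn φ K := fun x hx => (hφ x hx).continuousAt.continuousWithinAt
  refine measure_null_of_locally_null _ fun x hx => ?_
  obtain ⟨i, c, hc, s, hs, hexp⟩ :=
    exists_lineExpanding ((hφ x hx.1).hasStrictFDerivAt one_ne_zero) (hne x hx.1 hx.2)
  obtain ⟨ε, hε, hrs⟩ := Metric.nhds_basis_closedBall.mem_iff.1 hs
  refine ⟨_, inter_mem_nhdsWithin _ (Metric.closedBall_mem_nhds x hε), ?_⟩
  refine measure_mono_null (fun y hy => ?_) (volume_levelSet_eq_zero_of_lineExpanding (r := r) hc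
    (s := K ∩ Metric.closedBall x ε) (fun y hy z hz => hexp y (hrs hy.2) z (hrs hz.2))
    (hK.inter Metric.isClosed_closedBall) (hφc.mono Set.inter_subset_left))
  exact ⟨⟨hy.1.1, hy.2⟩, hy.1.2⟩

end Shell

section Homogeneous
variable {X V : Type*} [TopologicalSpace X] [NormedAddCommGroup V] [NormedSpace ℝ V]
  [FiniteDimensional ℝ V]

/-- A continuous family of functions which are homogeneous of degree two is bounded by a multiple
of the square of the norm, uniformly on compact sets. -/
theorem exists_abs_le_mul_norm_sq {K : Set X} (hK : IsCompact K) {Q : X → V → ℝ}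
    (hQ : ContinuousOn (fun z : X × V => Q z.1 z.2) (K ×ˢ Set.univ))
    (hhom : ∀ x ∈ K, ∀ (r : ℝ) (v : V), Q x (r • v) = r ^ 2 * Q x v) :
    ∃ M : ℝ, 0 ≤ M ∧ ∀ x ∈ K, ∀ v, |Q x v| ≤ M * ‖v‖ ^ 2 := by
  have hc : IsCompact (K ×ˢ Metric.closedBall (0 : V) 1) :=
    hK.prod (isCompact_closedBall (0 : V) 1)
  obtain ⟨M, hM⟩ := hc.exists_bound_of_continuousOn
    (hQ.mono (Set.prod_mono_right (Set.subset_univ _)))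
  refine ⟨max M 0, le_max_right _ _, fun x hx v => ?_⟩
  rcases eq_or_ne v 0 with rfl | hv
  · have := hhom x hx 0 0
    simp at this
    simp [this]
  have hn : 0 < ‖v‖ := norm_pos_iff.2 hv
  have h1 : Q x v = ‖v‖ ^ 2 * Q x (‖v‖⁻¹ • v) := by
    rw [← hhom x hx, smul_smul, mul_inv_cancel₀ hn.ne', one_smul]
  have h2 : |Q x (‖v‖⁻¹ • v)| ≤ M :=
    hM (x, ‖v‖⁻¹ • v) ⟨hx, by simp [norm_smul, hn.ne']⟩
  rw [h1, abs_mul, abs_of_nonneg (by positivity), mul_comm]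
  gcongr
  exact h2.trans (le_max_left _ _)

/-- A continuous family of positive definite functions which are homogeneous of degree two is
bounded below by a multiple of the square of the norm, uniformly on compact sets. -/
theorem exists_mul_norm_sq_le {K : Set X} (hK : IsCompact K) {Q : X → V → ℝ}
    (hQ : ContinuousOn (fun z : X × V => Q z.1 z.2) (K ×ˢ Set.univ))
    (hhom : ∀ x ∈ K, ∀ (r : ℝ) (v : V), Q x (r • v) = r ^ 2 * Q x v)
    (hpos : ∀ x ∈ K, ∀ v ≠ 0, 0 < Q x v) :
    ∃ c : ℝ, 0 < c ∧ ∀ x ∈ K, ∀ v, c * ‖v‖ ^ 2 ≤ Q x v := by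
  have hc : IsCompact (K ×ˢ Metric.sphere (0 : V) 1) := hK.prod (isCompact_sphere (0 : V) 1)
  have hQ' : ContinuousOn (fun z : X × V => Q z.1 z.2) (K ×ˢ Metric.sphere (0 : V) 1) :=
    hQ.mono (Set.prod_mono_right (Set.subset_univ _))
  have hmin : ∃ c : ℝ, 0 < c ∧ ∀ x ∈ K, ∀ v ∈ Metric.sphere (0 : V) 1, c ≤ Q x v := by
    rcases (K ×ˢ Metric.sphere (0 : V) 1).eq_empty_or_nonempty with he | hne
    · refine ⟨1, one_pos, fun x hx v hv => ?_⟩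
      exact absurd (Set.mk_mem_prod hx hv) (by simp [he])
    · obtain ⟨z, hz, hzmin⟩ := hc.exists_isMinOn hne hQ'
      refine ⟨Q z.1 z.2, hpos _ hz.1 _ ?_, fun x hx v hv => hzmin (Set.mk_mem_prod hx hv)⟩
      exact ne_zero_of_mem_unit_sphere ⟨z.2, hz.2⟩
  obtain ⟨c, hc0, hc1⟩ := hmin
  refine ⟨c, hc0, fun x hx v => ?_⟩
  rcases eq_or_ne v 0 with rfl | hv
  · have := hhom x hx 0 0
    simp at this
    simp [this]
  have hn : 0 < ‖v‖ := norm_pos_iff.2 hv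
  have h1 : Q x v = ‖v‖ ^ 2 * Q x (‖v‖⁻¹ • v) := by
    rw [← hhom x hx, smul_smul, mul_inv_cancel₀ hn.ne', one_smul]
  have h2 : c ≤ Q x (‖v‖⁻¹ • v) := hc1 x hx _ (by simp [norm_smul, hn.ne'])
  rw [h1, mul_comm]
  gcongr

end Homogeneous

section Divergence
variable {d : ℕ}

theorem partialDeriv_congr {f g : EuclideanSpace ℝ (Fin d) → ℝ} {x : EuclideanSpace ℝ (Fin d)}
    (h : f =ᶠ[𝓝 x] g) (i : Fin d) : partialDeriv i f x = partialDeriv i g x := by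
  rw [partialDeriv, partialDeriv, h.fderiv_eq]

theorem integral_partialDeriv_eq_zero {f : EuclideanSpace ℝ (Fin d) → ℝ} (hf : ContDiff ℝ 1 f)
    (hs : HasCompactSupport f) (i : Fin d) : ∫ x, partialDeriv i f x = 0 := by
  have hc : Continuous fun x => fderiv ℝ f x (EuclideanSpace.single i 1) :=
    (hf.continuous_fderiv one_ne_zero).clm_apply continuous_const
  have hs' : HasCompactSupport fun x => fderiv ℝ f x (EuclideanSpace.single i 1) :=
    hs.fderiv_apply ℝ _
  have := integral_mul_fderiv_eq_neg_fderiv_mul_of_integrable (μ := volume) (𝕜 := ℝ)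
    (f := fun _ : EuclideanSpace ℝ (Fin d) => (1 : ℝ)) (g := f) (v := EuclideanSpace.single i 1)
    (by simp) (by simpa using hc.integrable_of_hasCompactSupport hs')
    (by simpa using hf.continuous.integrable_of_hasCompactSupport hs)
    (fun _ _ => differentiableAt_const _) (fun _ _ => hf.differentiable one_ne_zero _)
  simpa [partialDeriv] using this

variable {Ω O : Set (EuclideanSpace ℝ (Fin d))}

theorem setIntegral_partialDeriv_eq_zero (hΩ : IsOpen Ω) (hK : IsCompact (closure O))
    (hKΩ : closure O ⊆ Ω) {f : EuclideanSpace ℝ (Fin d) → ℝ} (hf : ContDiffOn ℝ 1 f Ω)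
    (h0 : ∀ x ∈ Ω, x ∉ O → f x = 0) (i : Fin d) :
    ∫ x in closure O, partialDeriv i f x = 0 := by
  have hout : ∀ x ∉ closure O, Ω.indicator f x = 0 := by
    intro x hx
    by_cases hxΩ : x ∈ Ω
    · rw [Set.indicator_of_mem hxΩ, h0 x hxΩ fun h => hx (subset_closure h)]
    · exact Set.indicator_of_notMem hxΩ f
  have hout' : ∀ x ∉ closure O, Ω.indicator f =ᶠ[𝓝 x] fun _ => 0 := fun x hx =>
    Filter.eventuallyEq_of_mem (isClosed_closure.isOpen_compl.mem_nhds hx) hout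
  have hin : ∀ x ∈ Ω, Ω.indicator f =ᶠ[𝓝 x] f := fun x hx =>
    Filter.eventuallyEq_of_mem (hΩ.mem_nhds hx) fun y hy => Set.indicator_of_mem hy f
  have hcd : ContDiff ℝ 1 (Ω.indicator f) := by
    rw [contDiff_iff_contDiffAt]
    intro x
    by_cases hx : x ∈ Ω
    · exact (hf.contDiffAt (hΩ.mem_nhds hx)).congr_of_eventuallyEq (hin x hx)
    · exact contDiffAt_const.congr_of_eventuallyEq (hout' x fun h => hx (hKΩ h))
  have := integral_partialDeriv_eq_zero hcd (HasCompactSupport.intro hK hout) i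
  rw [← this, ← integral_indicator isClosed_closure.measurableSet]
  refine integral_congr_ae (Eventually.of_forall fun x => ?_)
  by_cases hx : x ∈ closure O
  · simp only [Set.indicator_of_mem hx]
    exact (partialDeriv_congr (hin x (hKΩ hx)) i).symm
  · simp only [Set.indicator_of_notMem hx]
    rw [partialDeriv_congr (hout' x hx) i]
    simp [partialDeriv]

end Divergence

section EnergyCurrent
variable {d : ℕ}

/-- The flux, through a surface with conormal `q`, of the energy of a function with value `z.1`
and differential `z.2`, relative to a time function with differential `p`. -/
def energyFlux (A : Matrix (Fin d) (Fin d) ℝ) (q p : Fin d → ℝ) (z : ℝ × (Fin d → ℝ)) : ℝ :=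
  2 * matForm A p z.2 * matForm A q z.2 - matForm A q p * (matForm A z.2 z.2 + z.1 * z.1)

theorem continuous_energyFlux : Continuous
    (fun D : (Matrix (Fin d) (Fin d) ℝ × (Fin d → ℝ) × (Fin d → ℝ)) × (ℝ × (Fin d → ℝ)) =>
      energyFlux D.1.1 D.1.2.1 D.1.2.2 D.2) := by
  unfold energyFlux matForm
  fun_prop

theorem energyFlux_smul (A : Matrix (Fin d) (Fin d) ℝ) (q p : Fin d → ℝ) (r : ℝ)
    (z : ℝ × (Fin d → ℝ)) : energyFlux A q p (r • z) = r ^ 2 * energyFlux A q p z := by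
  simp only [energyFlux, Prod.smul_snd, Prod.smul_fst, matForm_smul_right, matForm_smul_left,
    smul_eq_mul]
  ring

theorem energyFlux_pos_of_timelike {n : ℕ} {A : Matrix (Fin (n + 1)) (Fin (n + 1)) ℝ}
    (hA : HasLorentzSignature A) {p q : Fin (n + 1) → ℝ} (hp : matForm A p p < 0)
    (hq : matForm A q q < 0) (hqp : matForm A q p < 0) {z : ℝ × (Fin (n + 1) → ℝ)} (hz : z ≠ 0) :
    0 < energyFlux A q p z := by
  obtain ⟨a, v⟩ := z
  simp only [energyFlux]
  by_cases hv : v = 0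
  · have ha : a ≠ 0 := by rintro rfl; exact hz (by rw [hv]; rfl)
    subst hv
    have h0 : ∀ x : Fin (n + 1) → ℝ, matForm A x 0 = 0 := fun x => by simp [matForm]
    rw [h0, h0, h0]
    nlinarith [mul_self_pos.2 ha]
  · have := energyFlux_pos hA hp hq hqp hv
    nlinarith [mul_self_nonneg a]

/-- The components of the energy current with multiplier `X`. -/
def energyCurrent (X : Fin d → ℝ) (A : Matrix (Fin d) (Fin d) ℝ) (a : ℝ) (v : Fin d → ℝ)
    (j : Fin d) : ℝ :=
  2 * (∑ i, X i * v i) * (∑ k, A j k * v k) - X j * (∑ k, ∑ l, A k l * v k * v l + a * a)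

theorem sum_mul_energyCurrent {A : Matrix (Fin d) (Fin d) ℝ} (hA : A.IsSymm) (q p : Fin d → ℝ)
    (a : ℝ) (v : Fin d → ℝ) :
    ∑ j, q j * energyCurrent (fun i => ∑ k, A i k * p k) A a v j = energyFlux A q p (a, v) := by
  have h1 : ∀ r s : Fin d → ℝ, matForm A r s = ∑ i, r i * ∑ k, A i k * s k := by
    intro r s
    simp only [matForm, Finset.mul_sum]
    exact Finset.sum_congr rfl fun i _ => Finset.sum_congr rfl fun k _ => by ring
  have h2 : ∑ i, (∑ k, A i k * p k) * v i = matForm A p v := by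
    rw [matForm_comm p v hA, h1]
    exact Finset.sum_congr rfl fun i _ => mul_comm _ _
  simp only [energyFlux, energyCurrent, h2]
  change _ = 2 * matForm A p v * matForm A q v - matForm A q p * (∑ k, ∑ l, A k l * v k * v l + a * a)
  rw [h1 q v, h1 q p, Finset.mul_sum, Finset.sum_mul, ← Finset.sum_sub_distrib]
  exact Finset.sum_congr rfl fun i _ => by ring

/-- The pointwise data which determine the divergence of the energy current: the multiplier, the
principal coefficients, the derivatives of both, and the lower order coefficients. -/
abbrev EnergyData (d : ℕ) : Type :=
  (Fin d → ℝ) × Matrix (Fin d) (Fin d) ℝ × (Fin d → Fin d → ℝ) × (Fin d → Fin d → Fin d → ℝ) ×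
    (Fin d → ℝ) × ℝ

/-- The divergence of the energy current of a function with value `z.1`, differential `z.2.1` and
image `z.2.2` under the differential operator. -/
def energyDivergence (D : EnergyData d) (z : ℝ × (Fin d → ℝ) × ℝ) : ℝ :=
  2 * (∑ i, D.1 i * z.2.1 i) * (z.2.2 - ∑ j, D.2.2.2.2.1 j * z.2.1 j - D.2.2.2.2.2 * z.1)
    + ∑ j, (2 * (∑ i, D.2.2.1 j i * z.2.1 i) * (∑ k, D.2.1 j k * z.2.1 k)
      + 2 * (∑ i, D.1 i * z.2.1 i) * (∑ k, D.2.2.2.1 j j k * z.2.1 k)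
      - D.2.2.1 j j * (∑ k, ∑ l, D.2.1 k l * z.2.1 k * z.2.1 l + z.1 * z.1)
      - D.1 j * (∑ k, ∑ l, D.2.2.2.1 j k l * z.2.1 k * z.2.1 l + 2 * z.1 * z.2.1 j))

theorem continuous_energyDivergence :
    Continuous (fun D : EnergyData d × (ℝ × (Fin d → ℝ) × ℝ) => energyDivergence D.1 D.2) := by
  unfold energyDivergence
  fun_prop

theorem energyDivergence_smul (D : EnergyData d) (r : ℝ) (z : ℝ × (Fin d → ℝ) × ℝ) :
    energyDivergence D (r • z) = r ^ 2 * energyDivergence D z := by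
  obtain ⟨X, A, dX, dA, b, c⟩ := D
  obtain ⟨a, v, l⟩ := z
  have h1 : ∀ f : Fin d → ℝ, ∑ i, f i * (r * v i) = r * ∑ i, f i * v i := fun f => by
    rw [Finset.mul_sum]; exact Finset.sum_congr rfl fun i _ => by ring
  have h2 : ∀ f : Fin d → Fin d → ℝ, ∑ k, ∑ l, f k l * (r * v k) * (r * v l)
      = r ^ 2 * ∑ k, ∑ l, f k l * v k * v l := fun f => by
    simp only [Finset.mul_sum]
    exact Finset.sum_congr rfl fun i _ => Finset.sum_congr rfl fun j _ => by ring
  simp only [energyDivergence, Prod.smul_mk, Pi.smul_apply, smul_eq_mul, h2, h2 (fun k l => A k l)]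
  simp only [h1]
  rw [mul_add (r ^ 2)]
  congr 1
  · ring
  · refine (Finset.sum_congr rfl fun j _ => ?_).trans (Finset.mul_sum _ _ _).symm
    ring

theorem hasDerivAt_energyCurrent (j : Fin d) {X : Fin d → ℝ → ℝ} {A : Fin d → Fin d → ℝ → ℝ}
    {v : Fin d → ℝ → ℝ} {a : ℝ → ℝ} {X' : Fin d → ℝ} {A' : Fin d → Fin d → ℝ} {v' : Fin d → ℝ}
    {a' : ℝ} {τ : ℝ} (hX : ∀ i, HasDerivAt (X i) (X' i) τ)
    (hA : ∀ k l, HasDerivAt (A k l) (A' k l) τ) (hv : ∀ i, HasDerivAt (v i) (v' i) τ)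
    (ha : HasDerivAt a a' τ) :
    HasDerivAt (fun τ => energyCurrent (fun i => X i τ) (fun k l => A k l τ) (a τ)
        (fun i => v i τ) j)
      (2 * (∑ i, (X' i * v i τ + X i τ * v' i)) * (∑ k, A j k τ * v k τ)
        + 2 * (∑ i, X i τ * v i τ) * (∑ k, (A' j k * v k τ + A j k τ * v' k))
        - (X' j * (∑ k, ∑ l, A k l τ * v k τ * v l τ + a τ * a τ)
          + X j τ * (∑ k, ∑ l, ((A' k l * v k τ + A k l τ * v' k) * v l τ
            + A k l τ * v k τ * v' l) + (a' * a τ + a τ * a')))) τ := by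
  unfold energyCurrent
  refine HasDerivAt.fun_sub (HasDerivAt.fun_mul (HasDerivAt.const_mul 2 ?_) ?_)
    ((hX j).fun_mul ((HasDerivAt.fun_sum fun k _ => HasDerivAt.fun_sum fun l _ =>
      ((hA k l).fun_mul (hv k)).fun_mul (hv l)).fun_add (ha.fun_mul ha)))
  · exact HasDerivAt.fun_sum fun i _ => (hX i).fun_mul (hv i)
  · exact HasDerivAt.fun_sum fun i _ => (hA j i).fun_mul (hv i)

theorem sum_deriv_energyCurrent {A : Matrix (Fin d) (Fin d) ℝ} (hA : A.IsSymm) (X : Fin d → ℝ)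
    (dX : Fin d → Fin d → ℝ) (dA : Fin d → Fin d → Fin d → ℝ) (b : Fin d → ℝ) (c a : ℝ)
    (v : Fin d → ℝ) {H : Fin d → Fin d → ℝ} (hH : ∀ i j, H i j = H j i) :
    ∑ j, (2 * (∑ i, (dX j i * v i + X i * H j i)) * (∑ k, A j k * v k)
        + 2 * (∑ i, X i * v i) * (∑ k, (dA j j k * v k + A j k * H j k))
        - (dX j j * (∑ k, ∑ l, A k l * v k * v l + a * a)
          + X j * (∑ k, ∑ l, ((dA j k l * v k + A k l * H j k) * v l
            + A k l * v k * H j l) + (v j * a + a * v j))))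
      = energyDivergence (X, A, dX, dA, b, c)
          (a, v, ∑ i, ∑ j, A i j * H i j + ∑ j, b j * v j + c * a) := by
  have h1 : ∀ j, ∑ k, ∑ l, ((dA j k l * v k + A k l * H j k) * v l + A k l * v k * H j l)
      = ∑ k, ∑ l, dA j k l * v k * v l + 2 * ∑ k, H j k * ∑ l, A k l * v l := by
    intro j
    have h2 : ∑ k, ∑ l, A k l * v k * H j l = ∑ k, H j k * ∑ l, A k l * v l := by
      rw [Finset.sum_comm]
      refine Finset.sum_congr rfl fun k _ => ?_
      rw [Finset.mul_sum]
      refine Finset.sum_congr rfl fun l _ => ?_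
      rw [hA.apply]; ring
    have h3 : ∑ k, ∑ l, A k l * H j k * v l = ∑ k, H j k * ∑ l, A k l * v l := by
      refine Finset.sum_congr rfl fun k _ => ?_
      rw [Finset.mul_sum]
      exact Finset.sum_congr rfl fun l _ => by ring
    simp only [add_mul, Finset.sum_add_distrib, h2, h3]
    ring
  have h4 : ∑ j, (∑ i, X i * H j i) * (∑ k, A j k * v k)
      = ∑ j, X j * ∑ k, H j k * ∑ l, A k l * v l := by
    simp only [Finset.sum_mul]
    rw [Finset.sum_comm]
    refine Finset.sum_congr rfl fun i _ => ?_
    rw [Finset.mul_sum]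
    refine Finset.sum_congr rfl fun j _ => ?_
    rw [hH]; ring
  simp only [h1, energyDivergence]
  have h5 : ∀ S T : ℝ, 2 * S * (T + ∑ j, b j * v j + c * a - ∑ j, b j * v j - c * a) = 2 * S * T :=
    fun S T => by ring
  rw [h5, Finset.mul_sum _ _ (2 * _), ← Finset.sum_add_distrib, ← sub_eq_zero, ← Finset.sum_sub_distrib]
  trans ∑ j, (2 * ((∑ i, X i * H j i) * (∑ k, A j k * v k))
    - 2 * (X j * ∑ k, H j k * ∑ l, A k l * v l))
  · refine Finset.sum_congr rfl fun j _ => ?_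
    simp only [Finset.sum_add_distrib]
    ring
  · rw [Finset.sum_sub_distrib, ← Finset.mul_sum, ← Finset.mul_sum, h4, sub_self]

end EnergyCurrent

section EnergyIdentity
variable {d : ℕ} {Ω O : Set (EuclideanSpace ℝ (Fin d))}
  {h : EuclideanSpace ℝ (Fin d) → Matrix (Fin d) (Fin d) ℝ}
  {b : EuclideanSpace ℝ (Fin d) → Fin d → ℝ} {c t w : EuclideanSpace ℝ (Fin d) → ℝ}

/-- The vector of the partial derivatives of a function. -/
noncomputable def partialDerivs (f : EuclideanSpace ℝ (Fin d) → ℝ)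
    (x : EuclideanSpace ℝ (Fin d)) : Fin d → ℝ := fun i => partialDeriv i f x

theorem contDiffOn_partialDeriv {m n : WithTop ℕ∞} (hΩ : IsOpen Ω)
    {f : EuclideanSpace ℝ (Fin d) → ℝ} (hf : ContDiffOn ℝ n f Ω) (hmn : m + 1 ≤ n) (i : Fin d) :
    ContDiffOn ℝ m (partialDeriv i f) Ω :=
  (hf.fderiv_of_isOpen hΩ hmn).clm_apply contDiffOn_const

theorem continuousOn_partialDerivs (hΩ : IsOpen Ω) {f : EuclideanSpace ℝ (Fin d) → ℝ}
    (hf : ContDiffOn ℝ 1 f Ω) : ContinuousOn (partialDerivs f) Ω :=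
  continuousOn_pi.2 fun i => (contDiffOn_partialDeriv (m := 0) hΩ hf (by simp) i).continuousOn

theorem hasDerivAt_partialDeriv {f : EuclideanSpace ℝ (Fin d) → ℝ}
    {x : EuclideanSpace ℝ (Fin d)} (hf : DifferentiableAt ℝ f x) (j : Fin d) :
    HasDerivAt (fun τ : ℝ => f (x + τ • EuclideanSpace.single j 1)) (partialDeriv j f x) 0 :=
  hf.hasFDerivAt.hasLineDerivAt _

theorem partialDeriv_comm (hΩ : IsOpen Ω) (hw : ContDiffOn ℝ 2 w Ω)
    {x : EuclideanSpace ℝ (Fin d)} (hx : x ∈ Ω) (i j : Fin d) :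
    partialDeriv i (partialDeriv j w) x = partialDeriv j (partialDeriv i w) x := by
  have hat := hw.contDiffAt (hΩ.mem_nhds hx)
  have hd : DifferentiableAt ℝ (fderiv ℝ w) x :=
    (hat.fderiv_right (m := 1) (by norm_num)).differentiableAt one_ne_zero
  have key : ∀ i j, partialDeriv i (partialDeriv j w) x =
      fderiv ℝ (fderiv ℝ w) x (EuclideanSpace.single i 1) (EuclideanSpace.single j 1) := by
    intro i j
    have h1 : HasFDerivAt (partialDeriv j w) _ x :=
      hd.hasFDerivAt.clm_apply (hasFDerivAt_const (EuclideanSpace.single j (1 : ℝ)) x)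
    rw [partialDeriv, h1.fderiv]
    simp
  rw [key, key]
  exact (hat.isSymmSndFDerivAt (by simp)).eq _ _

/-- The vector field which is dual to the differential of `t`. -/
noncomputable def timeField (h : EuclideanSpace ℝ (Fin d) → Matrix (Fin d) (Fin d) ℝ)
    (t : EuclideanSpace ℝ (Fin d) → ℝ) (i : Fin d) (x : EuclideanSpace ℝ (Fin d)) : ℝ :=
  ∑ k, h x i k * partialDeriv k t x

theorem contDiffOn_timeField (hΩ : IsOpen Ω) (hh : ∀ i j, ContDiffOn ℝ 1 (fun x => h x i j) Ω)
    (ht : ContDiffOn ℝ 2 t Ω) (i : Fin d) : ContDiffOn ℝ 1 (timeField h t i) Ω :=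
  ContDiffOn.sum fun k _ => (hh i k).mul (contDiffOn_partialDeriv hΩ ht (by norm_num) k)

/-- The coefficients of the divergence of the energy current. -/
noncomputable def energyData (h : EuclideanSpace ℝ (Fin d) → Matrix (Fin d) (Fin d) ℝ)
    (b : EuclideanSpace ℝ (Fin d) → Fin d → ℝ) (c t : EuclideanSpace ℝ (Fin d) → ℝ)
    (x : EuclideanSpace ℝ (Fin d)) : EnergyData d :=
  (fun i => timeField h t i x, h x, fun j i => partialDeriv j (timeField h t i) x,
    fun j k l => partialDeriv j (fun y => h y k l) x, b x, c x)

theorem continuousOn_energyData (hΩ : IsOpen Ω)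
    (hh : ∀ i j, ContDiffOn ℝ 1 (fun x => h x i j) Ω)
    (hb : ∀ j, ContinuousOn (fun x => b x j) Ω) (hc : ContinuousOn c Ω)
    (ht : ContDiffOn ℝ 2 t Ω) : ContinuousOn (energyData h b c t) Ω := by
  have hX := contDiffOn_timeField hΩ hh ht
  have hd : ∀ {f : EuclideanSpace ℝ (Fin d) → ℝ}, ContDiffOn ℝ 1 f Ω → ∀ j,
      ContinuousOn (partialDeriv j f) Ω := fun hf j =>
    (contDiffOn_partialDeriv (m := 0) hΩ hf (by simp) j).continuousOn
  refine ContinuousOn.prodMk (continuousOn_pi.2 fun i => (hX i).continuousOn)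
    (ContinuousOn.prodMk (continuousOn_pi.2 fun i => continuousOn_pi.2 fun j =>
      (hh i j).continuousOn)
    (ContinuousOn.prodMk (continuousOn_pi.2 fun j => continuousOn_pi.2 fun i => hd (hX i) j)
    (ContinuousOn.prodMk (continuousOn_pi.2 fun j => continuousOn_pi.2 fun k =>
      continuousOn_pi.2 fun l => hd (hh k l) j)
    (ContinuousOn.prodMk (continuousOn_pi.2 hb) hc))))

/-- The energy current of `w` relative to the time function `t`. -/
noncomputable def energyCurrentField (h : EuclideanSpace ℝ (Fin d) → Matrix (Fin d) (Fin d) ℝ)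
    (t w : EuclideanSpace ℝ (Fin d) → ℝ) (j : Fin d) (x : EuclideanSpace ℝ (Fin d)) : ℝ :=
  energyCurrent (fun i => timeField h t i x) (h x) (w x) (partialDerivs w x) j

theorem contDiffOn_energyCurrentField (hΩ : IsOpen Ω)
    (hh : ∀ i j, ContDiffOn ℝ 1 (fun x => h x i j) Ω) (ht : ContDiffOn ℝ 2 t Ω)
    (hw : ContDiffOn ℝ 2 w Ω) (j : Fin d) :
    ContDiffOn ℝ 1 (energyCurrentField h t w j) Ω := by
  have hX := contDiffOn_timeField hΩ hh ht
  have hv : ∀ i, ContDiffOn ℝ 1 (partialDeriv i w) Ω := contDiffOn_partialDeriv hΩ hw (by norm_num)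
  have hw1 := hw.of_le one_le_two
  unfold energyCurrentField energyCurrent partialDerivs
  exact ((contDiffOn_const.mul (ContDiffOn.sum fun i _ => (hX i).mul (hv i))).mul
    (ContDiffOn.sum fun k _ => (hh j k).mul (hv k))).sub ((hX j).mul
      ((ContDiffOn.sum fun k _ => ContDiffOn.sum fun l _ => ((hh k l).mul (hv k)).mul (hv l)).add
        (hw1.mul hw1)))

theorem sum_partialDeriv_energyCurrentField (hΩ : IsOpen Ω)
    (hh : ∀ i j, ContDiffOn ℝ 1 (fun x => h x i j) Ω) (ht : ContDiffOn ℝ 2 t Ω)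
    (hw : ContDiffOn ℝ 2 w Ω) {x : EuclideanSpace ℝ (Fin d)} (hx : x ∈ Ω) (hs : (h x).IsSymm) :
    ∑ j, partialDeriv j (energyCurrentField h t w j) x =
      energyDivergence (energyData h b c t x)
        (w x, partialDerivs w x, secondOrderOp h b c w x) := by
  have hdiff : ∀ {f : EuclideanSpace ℝ (Fin d) → ℝ}, ContDiffOn ℝ 1 f Ω →
      DifferentiableAt ℝ f x := fun hf =>
    (hf.contDiffAt (hΩ.mem_nhds hx)).differentiableAt one_ne_zero
  have hv : ∀ i, ContDiffOn ℝ 1 (partialDeriv i w) Ω := contDiffOn_partialDeriv hΩ hw (by norm_num)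
  refine (Finset.sum_congr rfl fun j _ => ?_).trans
    (sum_deriv_energyCurrent hs (fun i => timeField h t i x)
      (fun j i => partialDeriv j (timeField h t i) x)
      (fun j k l => partialDeriv j (fun y => h y k l) x) (b x) (c x) (w x) (partialDerivs w x)
      (H := fun i j => partialDeriv i (partialDeriv j w) x)
      (partialDeriv_comm hΩ hw hx))
  have h1 := hasDerivAt_partialDeriv
    (hdiff (contDiffOn_energyCurrentField hΩ hh ht hw j)) j
  have h2 := hasDerivAt_energyCurrent j
    (fun i => hasDerivAt_partialDeriv (hdiff (contDiffOn_timeField hΩ hh ht i)) j)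
    (fun k l => hasDerivAt_partialDeriv (hdiff (hh k l)) j)
    (fun i => hasDerivAt_partialDeriv (hdiff (hv i)) j)
    (hasDerivAt_partialDeriv (hdiff (hw.of_le one_le_two)) j)
  have h3 := h1.unique h2
  simpa only [zero_smul, add_zero, partialDerivs] using h3

/-- The integral identity for the energy current with a weight which is a product of functions of
`φ`, `ψ` and `t` and which vanishes outside of `O`. -/
theorem energy_identity (hΩ : IsOpen Ω) (hK : IsCompact (closure O)) (hKΩ : closure O ⊆ Ω)
    (hh : ∀ i j, ContDiffOn ℝ 1 (fun x => h x i j) Ω) (hs : ∀ x ∈ Ω, (h x).IsSymm)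
    (ht : ContDiffOn ℝ 2 t Ω) (hw : ContDiffOn ℝ 2 w Ω) (b : EuclideanSpace ℝ (Fin d) → Fin d → ℝ)
    (c : EuclideanSpace ℝ (Fin d) → ℝ)
    {φ ψ : EuclideanSpace ℝ (Fin d) → ℝ} (hφ : ContDiffOn ℝ 2 φ Ω) (hψ : ContDiffOn ℝ 2 ψ Ω)
    {α β γ : ℝ → ℝ} (hα : ContDiff ℝ 1 α) (hβ : ContDiff ℝ 1 β) (hγ : ContDiff ℝ 1 γ)
    (h0 : ∀ x ∈ Ω, x ∉ O → α (φ x) * β (ψ x) = 0) :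
    ∫ x in closure O,
      (deriv α (φ x) * β (ψ x) * γ (t x)
          * energyFlux (h x) (partialDerivs φ x) (partialDerivs t x) (w x, partialDerivs w x)
        + α (φ x) * deriv β (ψ x) * γ (t x)
          * energyFlux (h x) (partialDerivs ψ x) (partialDerivs t x) (w x, partialDerivs w x)
        + α (φ x) * β (ψ x) * deriv γ (t x)
          * energyFlux (h x) (partialDerivs t x) (partialDerivs t x) (w x, partialDerivs w x)
        + α (φ x) * β (ψ x) * γ (t x) * energyDivergence (energyData h b c t x)
            (w x, partialDerivs w x, secondOrderOp h b c w x)) = 0 := by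
  set J := energyCurrentField h t w
  have hJ : ∀ j, ContDiffOn ℝ 1 (J j) Ω := contDiffOn_energyCurrentField hΩ hh ht hw
  set η : EuclideanSpace ℝ (Fin d) → ℝ := fun x => α (φ x) * β (ψ x) * γ (t x)
  have hη : ContDiffOn ℝ 1 η Ω :=
    ((hα.comp_contDiffOn (hφ.of_le one_le_two)).mul
      (hβ.comp_contDiffOn (hψ.of_le one_le_two))).mul (hγ.comp_contDiffOn (ht.of_le one_le_two))
  have hV : ∀ j, ContDiffOn ℝ 1 (fun x => η x * J j x) Ω := fun j => hη.mul (hJ j)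
  have hint := fun j => setIntegral_partialDeriv_eq_zero hΩ hK hKΩ (hV j)
    (fun x hx hxO => by simp [η, h0 x hx hxO]) j
  have hsum : ∫ x in closure O, ∑ j, partialDeriv j (fun x => η x * J j x) x = 0 := by
    rw [integral_finsetSum]
    · exact Finset.sum_eq_zero fun j _ => hint j
    · intro j _
      exact (((contDiffOn_partialDeriv (m := 0) hΩ (hV j) (by simp) j).continuousOn).mono
        hKΩ).integrableOn_compact hK
  rw [← hsum]
  refine setIntegral_congr_fun isClosed_closure.measurableSet fun x hxK => ?_
  have hx := hKΩ hxK
  have hdiff : ∀ {f : EuclideanSpace ℝ (Fin d) → ℝ} {n : WithTop ℕ∞}, ContDiffOn ℝ n f Ω → n ≠ 0 →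
      DifferentiableAt ℝ f x := fun hf hn =>
    (hf.contDiffAt (hΩ.mem_nhds hx)).differentiableAt hn
  have hcomp : ∀ {a : ℝ → ℝ} {f : EuclideanSpace ℝ (Fin d) → ℝ}, ContDiff ℝ 1 a →
      ContDiffOn ℝ 2 f Ω → ∀ j, HasDerivAt
        (fun τ : ℝ => a (f (x + τ • EuclideanSpace.single j 1)))
        (deriv a (f x) * partialDeriv j f x) 0 := by
    intro a f ha hf j
    have h1 := hasDerivAt_partialDeriv (hdiff hf two_ne_zero) j
    have h2 : HasDerivAt a (deriv a (f x)) (f (x + (0 : ℝ) • EuclideanSpace.single j 1)) := by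
      rw [zero_smul, add_zero]
      exact (ha.differentiable one_ne_zero _).hasDerivAt
    exact h2.comp (0 : ℝ) h1
  have hj : ∀ j, partialDeriv j (fun x => η x * J j x) x =
      (deriv α (φ x) * β (ψ x) * γ (t x)) * (partialDerivs φ x j * J j x)
      + (α (φ x) * deriv β (ψ x) * γ (t x)) * (partialDerivs ψ x j * J j x)
      + (α (φ x) * β (ψ x) * deriv γ (t x)) * (partialDerivs t x j * J j x)
      + η x * partialDeriv j (J j) x := by
    intro j
    have h1 := hasDerivAt_partialDeriv (hdiff (hV j) one_ne_zero) j
    have h2 := (((hcomp hα hφ j).fun_mul (hcomp hβ hψ j)).fun_mul (hcomp hγ ht j)).fun_mul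
      (hasDerivAt_partialDeriv (hdiff (hJ j) one_ne_zero) j)
    have h3 := h1.unique h2
    simp only [zero_smul, add_zero] at h3
    rw [h3]
    simp only [partialDerivs, η]
    ring
  simp only [hj, Finset.sum_add_distrib, ← Finset.mul_sum]
  rw [sum_partialDeriv_energyCurrentField (b := b) (c := c) hΩ hh ht hw hx (hs x hx)]
  have hfl := fun q => sum_mul_energyCurrent (hs x hx) q (partialDerivs t x) (w x)
    (partialDerivs w x)
  rw [← hfl, ← hfl, ← hfl]
  rfl

end EnergyIdentity

section Cutoff
open Real

theorem deriv_smoothTransition_of_one_lt {x : ℝ} (hx : 1 < x) : deriv smoothTransition x = 0 := by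
  have : smoothTransition =ᶠ[𝓝 x] fun _ => 1 := by
    filter_upwards [lt_mem_nhds hx] with y hy using smoothTransition.one_of_one_le hy.le
  rw [this.deriv_eq, deriv_const]

theorem deriv_smoothTransition_of_neg {x : ℝ} (hx : x < 0) : deriv smoothTransition x = 0 := by
  have : smoothTransition =ᶠ[𝓝 x] fun _ => 0 := by
    filter_upwards [gt_mem_nhds hx] with y hy using smoothTransition.zero_of_nonpos hy.le
  rw [this.deriv_eq, deriv_const]

theorem exists_deriv_smoothTransition_le : ∃ B : ℝ, 0 ≤ B ∧ ∀ x, deriv smoothTransition x ≤ B := by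
  have hc : Continuous (deriv smoothTransition) :=
    (smoothTransition.contDiff (n := 1)).continuous_deriv le_rfl
  obtain ⟨B, hB⟩ := (isCompact_Icc (a := (0 : ℝ)) (b := 1)).bddAbove_image hc.continuousOn
  refine ⟨max B 0, le_max_right _ _, fun x => ?_⟩
  rcases lt_or_ge x 0 with h | h
  · rw [deriv_smoothTransition_of_neg h]; exact le_max_right _ _
  rcases lt_or_ge 1 x with h' | h'
  · rw [deriv_smoothTransition_of_one_lt h']; exact le_max_right _ _
  exact (hB ⟨x, ⟨h, h'⟩, rfl⟩).trans (le_max_left _ _)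

theorem deriv_smoothTransition_nonneg (x : ℝ) : 0 ≤ deriv smoothTransition x :=
  smoothTransition.monotone.deriv_nonneg

theorem hasDerivAt_smoothTransition (x : ℝ) :
    HasDerivAt smoothTransition (deriv smoothTransition x) x :=
  ((smoothTransition.contDiff (n := 1)).differentiable one_ne_zero x).hasDerivAt

/-- An exponentially decreasing weight which is cut off smoothly at time `s`. -/
noncomputable def timeWeight (k l s : ℝ) (r : ℝ) : ℝ :=
  smoothTransition (k * (s - r)) * ((s - r) * exp (-l * r))

variable {k l s r : ℝ}

theorem contDiff_timeWeight : ContDiff ℝ 1 (timeWeight k l s) :=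
  (smoothTransition.contDiff.comp (by fun_prop)).mul (by fun_prop)

theorem timeWeight_eq_zero (hk : 0 ≤ k) (hr : s ≤ r) : timeWeight k l s r = 0 := by
  rw [timeWeight, smoothTransition.zero_of_nonpos (by nlinarith), zero_mul]

theorem timeWeight_nonneg (hk : 0 ≤ k) : 0 ≤ timeWeight k l s r := by
  rcases le_total s r with h | h
  · rw [timeWeight_eq_zero hk h]
  · exact mul_nonneg (smoothTransition.nonneg _) (mul_nonneg (by linarith) (exp_pos _).le)

theorem timeWeight_le {s₀ : ℝ} (hk : 0 ≤ k) (hl : 0 ≤ l) (hr : s₀ ≤ r) (hs : s₀ ≤ s) :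
    timeWeight k l s r ≤ (s - s₀) * exp (-l * s₀) := by
  rcases le_total s r with h | h
  · rw [timeWeight_eq_zero hk h]
    exact mul_nonneg (by linarith) (exp_pos _).le
  · calc timeWeight k l s r ≤ 1 * ((s - r) * exp (-l * r)) :=
          mul_le_mul_of_nonneg_right (smoothTransition.le_one _)
            (mul_nonneg (by linarith) (exp_pos _).le)
      _ ≤ (s - s₀) * exp (-l * s₀) := by
          rw [one_mul]
          refine mul_le_mul (by linarith) (exp_le_exp.2 (by nlinarith)) (exp_pos _).le
            (by linarith)

theorem deriv_timeWeight_le (hk : 0 ≤ k) : deriv (timeWeight k l s) r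
    ≤ -(l * timeWeight k l s r) - smoothTransition (k * (s - r)) * exp (-l * r) := by
  have h1 : HasDerivAt (fun r => k * (s - r)) (k * -1) r :=
    ((hasDerivAt_id r).const_sub s).const_mul k
  have h2 : HasDerivAt (fun r => exp (-l * r)) (exp (-l * r) * (-l * 1)) r :=
    ((hasDerivAt_id r).const_mul (-l)).exp
  have h3 := ((hasDerivAt_smoothTransition (k * (s - r))).comp r h1).fun_mul
    (((hasDerivAt_id r).const_sub s).fun_mul h2)
  have h4 : HasDerivAt (timeWeight k l s) _ r := h3
  rw [h4.deriv]
  simp only [Function.comp_apply, id_eq, timeWeight]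
  have h5 : 0 ≤ deriv smoothTransition (k * (s - r)) * k * ((s - r) * exp (-l * r)) := by
    rcases lt_or_ge (s - r) 0 with h | h
    · rcases hk.eq_or_lt with rfl | hk'
      · simp
      · rw [deriv_smoothTransition_of_neg (by nlinarith)]; simp
    · exact mul_nonneg (mul_nonneg (deriv_smoothTransition_nonneg _) hk)
        (mul_nonneg h (exp_pos _).le)
  nlinarith

end Cutoff

section Region
variable {n : ℕ} {Ω O : Set (EuclideanSpace ℝ (Fin (n + 1)))}
  {h : EuclideanSpace ℝ (Fin (n + 1)) → Matrix (Fin (n + 1)) (Fin (n + 1)) ℝ}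
  {b : EuclideanSpace ℝ (Fin (n + 1)) → Fin (n + 1) → ℝ}
  {c φᵢ φₑ t w : EuclideanSpace ℝ (Fin (n + 1)) → ℝ} {s₀ s₁ : ℝ}

namespace IsSpacelikeSweptRegion

theorem initial_nonneg (hO : IsSpacelikeSweptRegion h Ω O φᵢ φₑ t s₀ s₁)
    {x : EuclideanSpace ℝ (Fin (n + 1))} (hx : x ∈ closure O) : 0 ≤ φᵢ x := by
  refine le_on_closure (f := fun _ => (0 : ℝ)) (fun y hy => ?_) continuousOn_const
    (hO.contDiffOn_initial.continuousOn.mono hO.closure_subset) hx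
  rw [hO.between] at hy
  exact hy.2.1.le

theorem final_nonpos (hO : IsSpacelikeSweptRegion h Ω O φᵢ φₑ t s₀ s₁)
    {x : EuclideanSpace ℝ (Fin (n + 1))} (hx : x ∈ closure O) : φₑ x ≤ 0 := by
  refine le_on_closure (g := fun _ => (0 : ℝ)) (fun y hy => ?_)
    (hO.contDiffOn_final.continuousOn.mono hO.closure_subset) continuousOn_const hx
  rw [hO.between] at hy
  exact hy.2.2.le

theorem time_mem_Icc (hO : IsSpacelikeSweptRegion h Ω O φᵢ φₑ t s₀ s₁)
    {x : EuclideanSpace ℝ (Fin (n + 1))} (hx : x ∈ closure O) : t x ∈ Set.Icc s₀ s₁ := by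
  rw [hO.swept] at hx
  obtain ⟨s, hs, hx⟩ := Set.mem_iUnion₂.1 hx
  exact hx.2 ▸ hs

theorem timelike_time (hO : IsSpacelikeSweptRegion h Ω O φᵢ φₑ t s₀ s₁)
    {x : EuclideanSpace ℝ (Fin (n + 1))} (hx : x ∈ closure O) : differentialProduct h t t x < 0 :=
  (hO.spacelike_leaves _ (hO.time_mem_Icc hx) x ⟨hx, rfl⟩).1

theorem fderiv_ne_zero_of_timelike {φ : EuclideanSpace ℝ (Fin (n + 1)) → ℝ}
    {x : EuclideanSpace ℝ (Fin (n + 1))} (hx : differentialProduct h φ φ x < 0) :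
    fderiv ℝ φ x ≠ 0 := by
  intro h0
  simp [differentialProduct, partialDeriv, h0] at hx

theorem volume_closure_diff (hO : IsSpacelikeSweptRegion h Ω O φᵢ φₑ t s₀ s₁) (hΩ : IsOpen Ω)
    (s : ℝ) : volume (sweptRegion O t s \ (O ∩ {x | t x < s})) = 0 := by
  have hat : ∀ {φ : EuclideanSpace ℝ (Fin (n + 1)) → ℝ}, ContDiffOn ℝ 2 φ Ω →
      ∀ x ∈ closure O, ContDiffAt ℝ 1 φ x := fun hφ x hx =>
    (hφ.contDiffAt (hΩ.mem_nhds (hO.closure_subset hx))).of_le one_le_two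
  have h1 : volume {x ∈ closure O | φᵢ x = 0} = 0 :=
    volume_levelSet_eq_zero isClosed_closure (hat hO.contDiffOn_initial) fun x hx h0 =>
      fderiv_ne_zero_of_timelike (hO.spacelike_initial x ⟨hx, h0⟩).1
  have h2 : volume {x ∈ closure O | φₑ x = 0} = 0 :=
    volume_levelSet_eq_zero isClosed_closure (hat hO.contDiffOn_final) fun x hx h0 =>
      fderiv_ne_zero_of_timelike (hO.spacelike_final x ⟨hx, h0⟩).1
  have h3 : volume {x ∈ closure O | t x = s} = 0 :=
    volume_levelSet_eq_zero isClosed_closure (hat hO.contDiffOn_time) fun x hx _ =>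
      fderiv_ne_zero_of_timelike (hO.timelike_time hx)
  refine measure_mono_null (fun x hx => ?_) (measure_union_null (measure_union_null h1 h2) h3)
  obtain ⟨⟨hxK, hxs⟩, hx2⟩ := hx
  by_contra hne
  simp only [Set.mem_union, Set.mem_ofPred_eq, not_or, not_and] at hne
  refine hx2 ⟨?_, lt_of_le_of_ne hxs (hne.2 hxK)⟩
  rw [hO.between]
  exact ⟨hO.closure_subset hxK, lt_of_le_of_ne (hO.initial_nonneg hxK) (Ne.symm (hne.1.1 hxK)),
    lt_of_le_of_ne (hO.final_nonpos hxK) (hne.1.2 hxK)⟩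

theorem isClosed_sweptRegion (hO : IsSpacelikeSweptRegion h Ω O φᵢ φₑ t s₀ s₁) (s : ℝ) :
    IsClosed (sweptRegion O t s) :=
  (hO.contDiffOn_time.continuousOn.mono hO.closure_subset).preimage_isClosed_of_isClosed
    isClosed_closure isClosed_Iic

theorem isCompact_initial (hO : IsSpacelikeSweptRegion h Ω O φᵢ φₑ t s₀ s₁) :
    IsCompact (levelSurface O φᵢ 0) :=
  hO.isCompact_closure.of_isClosed_subset
    ((hO.contDiffOn_initial.continuousOn.mono hO.closure_subset).preimage_isClosed_of_isClosed
      isClosed_closure isClosed_singleton) (Set.sep_subset _ _)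

theorem isOpen (hO : IsSpacelikeSweptRegion h Ω O φᵢ φₑ t s₀ s₁) (hΩ : IsOpen Ω) : IsOpen O := by
  have : O = Ω ∩ (φᵢ ⁻¹' Set.Ioi 0) ∩ (Ω ∩ φₑ ⁻¹' Set.Iio 0) := by
    rw [hO.between]
    ext x
    simp only [Set.mem_ofPred_eq, Set.mem_inter_iff, Set.mem_preimage, Set.mem_Ioi, Set.mem_Iio]
    tauto
  rw [this]
  exact (hO.contDiffOn_initial.continuousOn.isOpen_inter_preimage hΩ isOpen_Ioi).inter
    (hO.contDiffOn_final.continuousOn.isOpen_inter_preimage hΩ isOpen_Iio)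

theorem measurableSet_inter_le (hO : IsSpacelikeSweptRegion h Ω O φᵢ φₑ t s₀ s₁)
    (hΩ : IsOpen Ω) (s : ℝ) : MeasurableSet (O ∩ {x | t x ≤ s}) := by
  have h3 : O ∩ {x | t x ≤ s} = O ∩ sweptRegion O t s := by
    ext x
    exact ⟨fun hx => ⟨hx.1, subset_closure hx.1, hx.2⟩, fun hx => ⟨hx.1, hx.2.2⟩⟩
  rw [h3]
  exact (hO.isOpen hΩ).measurableSet.inter (hO.isClosed_sweptRegion s).measurableSet

end IsSpacelikeSweptRegion

/-- A function which is negative on the part of `K` where `φ` vanishes is negative near it. -/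
theorem exists_forall_neg_of_near {E : Type*} [TopologicalSpace E] [T2Space E] {K : Set E}
    (hK : IsCompact K) {φ g : E → ℝ} (hφ : ContinuousOn φ K) (hg : ContinuousOn g K)
    (hneg : ∀ x ∈ K, φ x ≤ 0) (h0 : ∀ x ∈ K, φ x = 0 → g x < 0) :
    ∃ k₀ : ℕ, ∀ k : ℕ, k₀ ≤ k → ∀ x ∈ K, -1 ≤ k * φ x → g x < 0 := by
  have hK' : IsCompact (K ∩ g ⁻¹' Set.Ici 0) :=
    hK.of_isClosed_subset (hg.preimage_isClosed_of_isClosed hK.isClosed isClosed_Ici)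
      Set.inter_subset_left
  rcases (K ∩ g ⁻¹' Set.Ici 0).eq_empty_or_nonempty with he | hne
  · refine ⟨0, fun k _ x hx _ => ?_⟩
    by_contra! hgx
    exact (he ▸ (⟨hx, hgx⟩ : x ∈ K ∩ g ⁻¹' Set.Ici 0) : x ∈ (∅ : Set E))
  · obtain ⟨y, hy, hmax⟩ := hK'.exists_isMaxOn hne (hφ.mono Set.inter_subset_left)
    have hy0 : φ y < 0 := lt_of_le_of_ne (hneg y hy.1) fun h => (h0 y hy.1 h).not_ge hy.2
    obtain ⟨k₀, hk₀⟩ := exists_nat_gt (1 / (-φ y))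
    refine ⟨k₀, fun k hk x hx hkx => ?_⟩
    by_contra! hgx
    have h1 : φ x ≤ φ y := hmax ⟨hx, hgx⟩
    have h2 : 1 / (-φ y) < k := hk₀.trans_le (Nat.cast_le.2 hk)
    rw [div_lt_iff₀ (by linarith)] at h2
    nlinarith [mul_le_mul_of_nonneg_left h1 (Nat.cast_nonneg (α := ℝ) k)]

theorem continuousOn_differentialProduct (hΩ : IsOpen Ω)
    (hh : ∀ i j, ContDiffOn ℝ 1 (fun x => h x i j) Ω)
    {φ ψ : EuclideanSpace ℝ (Fin (n + 1)) → ℝ} (hφ : ContDiffOn ℝ 2 φ Ω)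
    (hψ : ContDiffOn ℝ 2 ψ Ω) : ContinuousOn (differentialProduct h φ ψ) Ω :=
  continuousOn_finsetSum _ fun i _ => continuousOn_finsetSum _ fun j _ =>
    ((hh i j).continuousOn.mul (contDiffOn_partialDeriv (m := 1) hΩ hφ (by norm_num) i).continuousOn).mul
      (contDiffOn_partialDeriv (m := 1) hΩ hψ (by norm_num) j).continuousOn

theorem continuousOn_comp_prod {X D V Y : Type*} [TopologicalSpace X] [TopologicalSpace D]
    [TopologicalSpace V] [TopologicalSpace Y] {F : D × V → Y} (hF : Continuous F) {g : X → D}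
    {s : Set X} (hg : ContinuousOn g s) :
    ContinuousOn (fun z : X × V => F (g z.1, z.2)) (s ×ˢ Set.univ) :=
  hF.comp_continuousOn ((hg.comp continuousOn_fst fun _ hz => hz.1).prodMk continuousOn_snd)

theorem continuousOn_energyFlux (hΩ : IsOpen Ω)
    (hh : ∀ i j, ContDiffOn ℝ 1 (fun x => h x i j) Ω)
    {φ ψ : EuclideanSpace ℝ (Fin (n + 1)) → ℝ} (hφ : ContDiffOn ℝ 2 φ Ω)
    (hψ : ContDiffOn ℝ 2 ψ Ω) :
    ContinuousOn (fun z : EuclideanSpace ℝ (Fin (n + 1)) × (ℝ × (Fin (n + 1) → ℝ)) =>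
      energyFlux (h z.1) (partialDerivs φ z.1) (partialDerivs ψ z.1) z.2) (Ω ×ˢ Set.univ) := by
  have h1 : ContinuousOn h Ω := continuousOn_pi.2 fun i => continuousOn_pi.2 fun j =>
    (hh i j).continuousOn
  have h2 : ContinuousOn (fun x => (h x, partialDerivs φ x, partialDerivs ψ x)) Ω :=
    h1.prodMk ((continuousOn_partialDerivs hΩ (hφ.of_le one_le_two)).prodMk
      (continuousOn_partialDerivs hΩ (hψ.of_le one_le_two)))
  have h3 := continuousOn_comp_prod continuous_energyFlux h2
  exact h3

/-- Constants for the energy estimate which do not depend on the solution. -/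
theorem exists_energy_constants (hΩ : IsOpen Ω) (hh : ∀ i j, ContDiffOn ℝ 1 (fun x => h x i j) Ω)
    (hb : ∀ j, ContinuousOn (fun x => b x j) Ω) (hc : ContinuousOn c Ω)
    (hsig : ∀ x ∈ Ω, HasLorentzSignature (h x))
    (hO : IsSpacelikeSweptRegion h Ω O φᵢ φₑ t s₀ s₁) :
    ∃ c₀ M : ℝ, 0 < c₀ ∧ 0 ≤ M ∧
      (∀ x ∈ closure O, ∀ z,
        c₀ * ‖z‖ ^ 2 ≤ energyFlux (h x) (partialDerivs t x) (partialDerivs t x) z) ∧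
      (∀ x ∈ closure O, ∀ z,
        energyFlux (h x) (partialDerivs φᵢ x) (partialDerivs t x) z ≤ M * ‖z‖ ^ 2) ∧
      (∀ x ∈ closure O, ∀ z, energyDivergence (energyData h b c t x) z ≤ M * ‖z‖ ^ 2) ∧
      ∃ k₀ : ℕ, ∀ k : ℕ, k₀ ≤ k → ∀ x ∈ closure O, -1 ≤ k * φₑ x → ∀ z,
        0 ≤ energyFlux (h x) (partialDerivs φₑ x) (partialDerivs t x) z := by
  have hK := hO.isCompact_closure
  have hKΩ := hO.closure_subset
  have hKV : ∀ V : Type, closure O ×ˢ (Set.univ : Set V) ⊆ Ω ×ˢ Set.univ :=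
    fun _ => Set.prod_mono_left hKΩ
  obtain ⟨c₀, hc₀, H0⟩ := exists_mul_norm_sq_le hK
    (Q := fun x z => energyFlux (h x) (partialDerivs t x) (partialDerivs t x) z)
    ((continuousOn_energyFlux hΩ hh hO.contDiffOn_time hO.contDiffOn_time).mono (hKV _))
    (fun x _ r v => energyFlux_smul _ _ _ r v) (fun x hx z hz =>
      energyFlux_pos_of_timelike (hsig x (hKΩ hx)) (hO.timelike_time hx) (hO.timelike_time hx)
        (hO.timelike_time hx) hz)
  obtain ⟨M₁, hM₁, H1⟩ := exists_abs_le_mul_norm_sq hK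
    (Q := fun x z => energyFlux (h x) (partialDerivs φᵢ x) (partialDerivs t x) z)
    ((continuousOn_energyFlux hΩ hh hO.contDiffOn_initial hO.contDiffOn_time).mono (hKV _))
    (fun x _ r v => energyFlux_smul _ _ _ r v)
  have hdc := continuousOn_comp_prod continuous_energyDivergence
    (continuousOn_energyData hΩ hh hb hc hO.contDiffOn_time)
  obtain ⟨M₂, hM₂, H2⟩ := exists_abs_le_mul_norm_sq hK
    (Q := fun x z => energyDivergence (energyData h b c t x) z) (hdc.mono (hKV _))
    (fun x _ r v => energyDivergence_smul _ r v)
  have hce : ContinuousOn (fun x => max (differentialProduct h φₑ φₑ x)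
      (differentialProduct h φₑ t x)) (closure O) :=
    (ContinuousOn.sup
      (continuousOn_differentialProduct hΩ hh hO.contDiffOn_final hO.contDiffOn_final)
      (continuousOn_differentialProduct hΩ hh hO.contDiffOn_final hO.contDiffOn_time)).mono hKΩ
  obtain ⟨k₀, hk₀⟩ := exists_forall_neg_of_near hK (hO.contDiffOn_final.continuousOn.mono hKΩ) hce
    (fun x hx => hO.final_nonpos hx) (fun x hx h0 => max_lt (hO.spacelike_final x ⟨hx, h0⟩).1
      (hO.spacelike_final x ⟨hx, h0⟩).2)
  refine ⟨c₀, max M₁ M₂, hc₀, le_max_of_le_left hM₁, H0, fun x hx z => ?_, fun x hx z => ?_, k₀,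
    fun k hk x hx hkx z => ?_⟩
  · exact (le_abs_self _).trans ((H1 x hx z).trans (by gcongr; exact le_max_left _ _))
  · exact (le_abs_self _).trans ((H2 x hx z).trans (by gcongr; exact le_max_right _ _))
  · obtain ⟨h1, h2⟩ := max_lt_iff.1 (hk₀ k hk x hx hkx)
    rcases eq_or_ne z 0 with rfl | hz
    · simp [energyFlux, matForm]
    · exact (energyFlux_pos_of_timelike (hsig x (hKΩ hx)) (hO.timelike_time hx) h1 h2 hz).le

end Region

section EnergyEstimate
variable {n : ℕ} {Ω O : Set (EuclideanSpace ℝ (Fin (n + 1)))}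
  {h : EuclideanSpace ℝ (Fin (n + 1)) → Matrix (Fin (n + 1)) (Fin (n + 1)) ℝ}
  {b : EuclideanSpace ℝ (Fin (n + 1)) → Fin (n + 1) → ℝ}
  {c φᵢ φₑ t w : EuclideanSpace ℝ (Fin (n + 1)) → ℝ} {s₀ s₁ : ℝ}

/-- The value and the partial derivatives of a function. -/
noncomputable def oneJet {d : ℕ} (w : EuclideanSpace ℝ (Fin d) → ℝ)
    (x : EuclideanSpace ℝ (Fin d)) : ℝ × (Fin d → ℝ) := (w x, partialDerivs w x)

theorem continuousOn_oneJet (hΩ : IsOpen Ω) (hw : ContDiffOn ℝ 1 w Ω) :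
    ContinuousOn (oneJet w) Ω :=
  hw.continuousOn.prodMk (continuousOn_partialDerivs hΩ hw)

theorem continuousOn_secondOrderOp (hΩ : IsOpen Ω)
    (hh : ∀ i j, ContDiffOn ℝ 1 (fun x => h x i j) Ω)
    (hb : ∀ j, ContinuousOn (fun x => b x j) Ω) (hc : ContinuousOn c Ω)
    (hw : ContDiffOn ℝ 2 w Ω) : ContinuousOn (secondOrderOp h b c w) Ω := by
  have h1 : ∀ j, ContDiffOn ℝ 1 (partialDeriv j w) Ω :=
    contDiffOn_partialDeriv hΩ hw (by norm_num)
  have h2 : ∀ i j, ContinuousOn (partialDeriv i (partialDeriv j w)) Ω := fun i j =>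
    (contDiffOn_partialDeriv (m := 0) hΩ (h1 j) (by simp) i).continuousOn
  exact ((continuousOn_finsetSum _ fun i _ => continuousOn_finsetSum _ fun j _ =>
    (hh i j).continuousOn.mul (h2 i j)).add (continuousOn_finsetSum _ fun j _ =>
      (hb j).mul (h1 j).continuousOn)).add (hc.mul hw.continuousOn)

theorem deriv_smoothTransition_comp_mul (a r : ℝ) :
    deriv (fun r => Real.smoothTransition (a * r)) r = deriv Real.smoothTransition (a * r) * a := by
  have h1 : HasDerivAt (fun r => a * r) (a * 1) r := (hasDerivAt_id r).const_mul a
  rw [mul_one] at h1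
  exact ((hasDerivAt_smoothTransition (a * r)).comp r h1).deriv

theorem norm_sq_jet_le {V : Type*} [NormedAddCommGroup V] (a : ℝ) (v : V) (l : ℝ) :
    ‖(a, v, l)‖ ^ 2 ≤ ‖(a, v)‖ ^ 2 + l ^ 2 := by
  have h1 : ‖(a, v, l)‖ = max ‖(a, v)‖ |l| := by
    simp only [Prod.norm_def, Real.norm_eq_abs, max_assoc]
  rw [h1]
  rcases max_choice ‖(a, v)‖ |l| with h | h <;> rw [h]
  · nlinarith [sq_nonneg l]
  · rw [sq_abs]; nlinarith [sq_nonneg ‖(a, v)‖]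

/-- The pointwise inequality behind the energy estimate: `F₁`, `F₂`, `F₃` are the fluxes of the
energy through the initial, the final and the time surfaces. -/
theorem weighted_flux_le {c₀ M N ℓ α α' β β' γ γ' q F₁ F₂ F₃ Q : ℝ} (hc₀ : 0 < c₀) (hM : 0 ≤ M)
    (hN : 0 ≤ N) (hα : 0 ≤ α) (hα' : 0 ≤ α') (hβ : 0 ≤ β) (hβ₁ : β ≤ 1) (hγ : 0 ≤ γ)
    (hγ' : γ' ≤ -(M / c₀ * γ) - q) (hq : 0 ≤ q) (hF₁ : F₁ ≤ M * N) (hF₂ : β' * F₂ ≤ 0)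
    (hF₃ : c₀ * N ≤ F₃) (hQ : Q ≤ M * (N + ℓ)) :
    α * β * q * (c₀ * N) ≤ -(α' * β * γ * F₁ + α * β' * γ * F₂ + α * β * γ' * F₃ + α * β * γ * Q)
      + (α' * γ * (M * N) + α * β * γ * (M * ℓ)) := by
  have hab := mul_nonneg hα hβ
  have habg := mul_nonneg hab hγ
  have hcN : 0 ≤ c₀ * N := by positivity
  have h1 : α' * β * γ * F₁ ≤ α' * γ * (M * N) := by
    calc α' * β * γ * F₁ ≤ α' * β * γ * (M * N) :=
          mul_le_mul_of_nonneg_left hF₁ (by positivity)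
      _ = β * (α' * γ * (M * N)) := by ring
      _ ≤ 1 * (α' * γ * (M * N)) := mul_le_mul_of_nonneg_right hβ₁ (by positivity)
      _ = _ := one_mul _
  have h2 : α * β' * γ * F₂ ≤ 0 := by
    have := mul_nonneg (mul_nonneg hα hγ) (neg_nonneg.2 hF₂)
    linarith
  have h3 : α * β * γ' * F₃ ≤ α * β * (-(M / c₀ * γ) - q) * (c₀ * N) := by
    have h4 : 0 ≤ M / c₀ * γ := by positivity
    have h5 : γ' * F₃ ≤ (-(M / c₀ * γ) - q) * F₃ :=
      mul_le_mul_of_nonneg_right hγ' (hcN.trans hF₃)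
    have h6 : (-(M / c₀ * γ) - q) * F₃ ≤ (-(M / c₀ * γ) - q) * (c₀ * N) :=
      mul_le_mul_of_nonpos_left hF₃ (by linarith)
    have := mul_le_mul_of_nonneg_left (h5.trans h6) hab
    linarith
  have h4 : α * β * γ * Q ≤ α * β * γ * (M * (N + ℓ)) := mul_le_mul_of_nonneg_left hQ habg
  have h5 : α * β * (-(M / c₀ * γ) - q) * (c₀ * N)
      = -(α * β * γ * (M * N)) - α * β * q * (c₀ * N) := by
    field_simp
  rw [h5] at h3
  linarith

theorem weighted_energy_le (hΩ : IsOpen Ω) (hh : ∀ i j, ContDiffOn ℝ 1 (fun x => h x i j) Ω)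
    (hb : ∀ j, ContinuousOn (fun x => b x j) Ω) (hc : ContinuousOn c Ω)
    (hsig : ∀ x ∈ Ω, HasLorentzSignature (h x))
    (hO : IsSpacelikeSweptRegion h Ω O φᵢ φₑ t s₀ s₁) {c₀ M B : ℝ} (hc₀ : 0 < c₀) (hM : 0 ≤ M)
    (hB : 0 ≤ B)
    (H0 : ∀ x ∈ closure O, ∀ z,
      c₀ * ‖z‖ ^ 2 ≤ energyFlux (h x) (partialDerivs t x) (partialDerivs t x) z)
    (H1 : ∀ x ∈ closure O, ∀ z,
      energyFlux (h x) (partialDerivs φᵢ x) (partialDerivs t x) z ≤ M * ‖z‖ ^ 2)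
    (H2 : ∀ x ∈ closure O, ∀ z, energyDivergence (energyData h b c t x) z ≤ M * ‖z‖ ^ 2)
    (HB : ∀ r, deriv Real.smoothTransition r ≤ B) {k : ℕ}
    (Hk : ∀ x ∈ closure O, -1 ≤ k * φₑ x → ∀ z,
      0 ≤ energyFlux (h x) (partialDerivs φₑ x) (partialDerivs t x) z)
    (hw : ContDiffOn ℝ 2 w Ω) {s : ℝ} (hs : s ∈ Set.Icc s₀ s₁) :
    ∫⁻ x in closure O, ENNReal.ofReal (c₀ * Real.exp (-(M / c₀) * s₁)
        * (Real.smoothTransition (k * φᵢ x) * Real.smoothTransition (-k * φₑ x)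
          * Real.smoothTransition (k * (s - t x)) * ‖oneJet w x‖ ^ 2))
      ≤ ENNReal.ofReal (M * B * ((s - s₀) * Real.exp (-(M / c₀) * s₀)))
          * (∫⁻ x in shell (closure O) φᵢ k, (k : ℝ≥0∞) * (‖oneJet w x‖₊ ^ 2 : ℝ≥0))
        + ENNReal.ofReal (M * ((s - s₀) * Real.exp (-(M / c₀) * s₀)))
          * ∫⁻ x in O ∩ {x | t x ≤ s}, ENNReal.ofReal (secondOrderOp h b c w x ^ 2) := by
  have hK := hO.isCompact_closure
  have hKΩ := hO.closure_subset
  have hKm : MeasurableSet (closure O) := isClosed_closure.measurableSet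
  have hk0 : (0 : ℝ) ≤ k := Nat.cast_nonneg k
  have hl : 0 ≤ M / c₀ := by positivity
  set D := (s - s₀) * Real.exp (-(M / c₀) * s₀) with hD
  have hD0 : 0 ≤ D := mul_nonneg (by linarith [hs.1]) (Real.exp_pos _).le
  set α : ℝ → ℝ := fun r => Real.smoothTransition (k * r) with hα
  set β : ℝ → ℝ := fun r => Real.smoothTransition (-k * r) with hβ
  set γ : ℝ → ℝ := timeWeight k (M / c₀) s with hγ
  have hαc : ContDiff ℝ 1 α := Real.smoothTransition.contDiff.comp (by fun_prop)
  have hβc : ContDiff ℝ 1 β := Real.smoothTransition.contDiff.comp (by fun_prop)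
  have hγc : ContDiff ℝ 1 γ := contDiff_timeWeight
  have hα0 : ∀ r, 0 ≤ α r := fun r => Real.smoothTransition.nonneg _
  have hα1 : ∀ r, α r ≤ 1 := fun r => Real.smoothTransition.le_one _
  have hβ0 : ∀ r, 0 ≤ β r := fun r => Real.smoothTransition.nonneg _
  have hβ1 : ∀ r, β r ≤ 1 := fun r => Real.smoothTransition.le_one _
  have hγ0 : ∀ r, 0 ≤ γ r := fun r => timeWeight_nonneg hk0
  have hα'0 : ∀ r, 0 ≤ deriv α r := fun r => by
    rw [hα, deriv_smoothTransition_comp_mul]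
    exact mul_nonneg (deriv_smoothTransition_nonneg _) hk0
  have hαβ : ∀ x ∈ Ω, x ∉ O → α (φᵢ x) * β (φₑ x) = 0 := by
    intro x hx hxO
    rw [hO.between] at hxO
    rcases le_or_gt (φᵢ x) 0 with h1 | h1
    · rw [hα]
      simp only
      rw [Real.smoothTransition.zero_of_nonpos (mul_nonpos_of_nonneg_of_nonpos hk0 h1), zero_mul]
    · have h2 : 0 ≤ φₑ x := not_lt.1 fun h2 => hxO ⟨hx, h1, h2⟩
      rw [hβ]
      simp only
      rw [Real.smoothTransition.zero_of_nonpos (by nlinarith), mul_zero]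
  have hident := energy_identity hΩ hK hKΩ hh (fun x hx => (hsig x hx).1) hO.contDiffOn_time hw b c
    hO.contDiffOn_initial hO.contDiffOn_final hαc hβc hγc hαβ
  set I : EuclideanSpace ℝ (Fin (n + 1)) → ℝ := fun x =>
      deriv α (φᵢ x) * β (φₑ x) * γ (t x)
          * energyFlux (h x) (partialDerivs φᵢ x) (partialDerivs t x) (oneJet w x)
        + α (φᵢ x) * deriv β (φₑ x) * γ (t x)
          * energyFlux (h x) (partialDerivs φₑ x) (partialDerivs t x) (oneJet w x)
        + α (φᵢ x) * β (φₑ x) * deriv γ (t x)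
          * energyFlux (h x) (partialDerivs t x) (partialDerivs t x) (oneJet w x)
        + α (φᵢ x) * β (φₑ x) * γ (t x) * energyDivergence (energyData h b c t x)
            (w x, partialDerivs w x, secondOrderOp h b c w x)
  change ∫ x in closure O, I x = 0 at hident
  set R₁ : EuclideanSpace ℝ (Fin (n + 1)) → ℝ := fun x =>
    deriv α (φᵢ x) * γ (t x) * (M * ‖oneJet w x‖ ^ 2)
  set R₂ : EuclideanSpace ℝ (Fin (n + 1)) → ℝ := fun x =>
    α (φᵢ x) * β (φₑ x) * γ (t x) * (M * secondOrderOp h b c w x ^ 2)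
  set q : EuclideanSpace ℝ (Fin (n + 1)) → ℝ := fun x => c₀ * Real.exp (-(M / c₀) * s₁)
        * (α (φᵢ x) * β (φₑ x) * Real.smoothTransition (k * (s - t x)) * ‖oneJet w x‖ ^ 2)
  have hq0 : ∀ x, 0 ≤ q x := fun x => by
    have h1 := hα0 (φᵢ x)
    have h2 := hβ0 (φₑ x)
    have h3 := Real.smoothTransition.nonneg (k * (s - t x))
    positivity
  have hR₁0 : ∀ x, 0 ≤ R₁ x := fun x =>
    mul_nonneg (mul_nonneg (hα'0 _) (hγ0 _)) (by positivity)
  have hR₂0 : ∀ x, 0 ≤ R₂ x := fun x =>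
    mul_nonneg (mul_nonneg (mul_nonneg (hα0 _) (hβ0 _)) (hγ0 _)) (by positivity)
  -- continuity
  have cφ := hO.contDiffOn_initial.continuousOn
  have cψ := hO.contDiffOn_final.continuousOn
  have ct := hO.contDiffOn_time.continuousOn
  have cz := continuousOn_oneJet hΩ (hw.of_le one_le_two)
  have cL := continuousOn_secondOrderOp hΩ hh hb hc hw
  have cα := hαc.continuous.comp_continuousOn cφ
  have cβ := hβc.continuous.comp_continuousOn cψ
  have cγ := hγc.continuous.comp_continuousOn ct
  have cα' := (hαc.continuous_deriv le_rfl).comp_continuousOn cφ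
  have cβ' := (hβc.continuous_deriv le_rfl).comp_continuousOn cψ
  have cγ' := (hγc.continuous_deriv le_rfl).comp_continuousOn ct
  have cflux : ∀ {φ}, ContDiffOn ℝ 2 φ Ω → ContinuousOn (fun x =>
      energyFlux (h x) (partialDerivs φ x) (partialDerivs t x) (oneJet w x)) Ω := by
    intro φ hφ
    have h1 := (continuousOn_energyFlux hΩ hh hφ hO.contDiffOn_time).comp
      (continuousOn_id.prodMk cz) (fun x hx => ⟨hx, trivial⟩)
    exact h1
  have cdiv : ContinuousOn (fun x => energyDivergence (energyData h b c t x)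
      (w x, partialDerivs w x, secondOrderOp h b c w x)) Ω := by
    have h1 := continuous_energyDivergence.comp_continuousOn
      ((continuousOn_energyData hΩ hh hb hc hO.contDiffOn_time).prodMk
        (hw.continuousOn.prodMk ((continuousOn_partialDerivs hΩ (hw.of_le one_le_two)).prodMk cL)))
    exact h1
  have cI : ContinuousOn I Ω :=
    ((((cα'.mul cβ).mul cγ).mul (cflux hO.contDiffOn_initial)).add
      (((cα.mul cβ').mul cγ).mul (cflux hO.contDiffOn_final))).add
      (((cα.mul cβ).mul cγ').mul (cflux hO.contDiffOn_time)) |>.add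
      (((cα.mul cβ).mul cγ).mul cdiv)
  have cR₁ : ContinuousOn R₁ Ω :=
    (cα'.mul cγ).mul (continuousOn_const.mul (cz.norm.pow 2))
  have cR₂ : ContinuousOn R₂ Ω :=
    ((cα.mul cβ).mul cγ).mul (continuousOn_const.mul (cL.pow 2))
  have cq : ContinuousOn q Ω :=
    continuousOn_const.mul (((cα.mul cβ).mul (Real.smoothTransition.continuous.comp_continuousOn
      (continuousOn_const.mul (continuousOn_const.sub ct)))).mul (cz.norm.pow 2))
  have hint : ∀ {f : EuclideanSpace ℝ (Fin (n + 1)) → ℝ}, ContinuousOn f Ω →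
      IntegrableOn f (closure O) := fun hf => (hf.mono hKΩ).integrableOn_compact hK
  -- the pointwise inequality
  have hpt : ∀ x ∈ closure O, q x ≤ -I x + (R₁ x + R₂ x) := by
    intro x hx
    have ht := hO.time_mem_Icc hx
    refine le_trans ?_ (weighted_flux_le (q := Real.smoothTransition (k * (s - t x)) *
      Real.exp (-(M / c₀) * t x)) hc₀ hM (sq_nonneg ‖oneJet w x‖) (hα0 (φᵢ x)) (hα'0 (φᵢ x))
      (hβ0 (φₑ x)) (hβ1 (φₑ x)) (hγ0 (t x)) (deriv_timeWeight_le hk0)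
      (mul_nonneg (Real.smoothTransition.nonneg _) (Real.exp_pos _).le) (H1 x hx _) ?_ (H0 x hx _)
      ((H2 x hx _).trans (mul_le_mul_of_nonneg_left (norm_sq_jet_le _ _ _) hM)))
    · have h1 : Real.exp (-(M / c₀) * s₁) ≤ Real.exp (-(M / c₀) * t x) :=
        Real.exp_le_exp.2 (by nlinarith [ht.2])
      have h2 : 0 ≤ α (φᵢ x) * β (φₑ x) * Real.smoothTransition (k * (s - t x))
          * (c₀ * ‖oneJet w x‖ ^ 2) :=
        mul_nonneg (mul_nonneg (mul_nonneg (hα0 _) (hβ0 _)) (Real.smoothTransition.nonneg _))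
          (by positivity)
      have h3 := mul_le_mul_of_nonneg_left h1 h2
      simp only [q]
      linarith
    · rw [hβ, deriv_smoothTransition_comp_mul]
      rcases lt_or_ge ((k : ℝ) * φₑ x) (-1) with h1 | h1
      · rw [deriv_smoothTransition_of_one_lt (by linarith)]; simp
      · have h2 := mul_nonneg (mul_nonneg (deriv_smoothTransition_nonneg (-k * φₑ x)) hk0)
          (Hk x hx h1 (oneJet w x))
        linarith
  have hreal : ∫ x in closure O, q x ≤ ∫ x in closure O, (R₁ x + R₂ x) := by
    have h1 := setIntegral_mono_on (hint cq) ((hint cI).neg.add (hint (cR₁.add cR₂))) hKm hpt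
    have h2 : ∫ x in closure O, (-I x + (R₁ x + R₂ x))
        = -(∫ x in closure O, I x) + ∫ x in closure O, (R₁ x + R₂ x) := by
      rw [← integral_neg]
      exact integral_add (hint cI).neg (hint (cR₁.add cR₂))
    rw [hident, neg_zero, zero_add] at h2
    exact h1.trans_eq h2
  have hae : ∀ {f : EuclideanSpace ℝ (Fin (n + 1)) → ℝ}, ContinuousOn f Ω →
      AEMeasurable (fun x => ENNReal.ofReal (f x)) (volume.restrict (closure O)) := fun hf =>
    ((hf.mono hKΩ).aemeasurable hKm).ennreal_ofReal
  have cOm := hO.measurableSet_inter_le hΩ s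
  have hγD : ∀ x ∈ closure O, γ (t x) ≤ D := fun x hx =>
    timeWeight_le hk0 hl (hO.time_mem_Icc hx).1 hs.1
  have hi₁ : ∫⁻ x in closure O, ENNReal.ofReal (R₁ x) ≤ ENNReal.ofReal (M * B * D)
      * ∫⁻ x in shell (closure O) φᵢ k, (k : ℝ≥0∞) * (‖oneJet w x‖₊ ^ 2 : ℝ≥0) := by
    rw [← lintegral_const_mul' _ _ ENNReal.ofReal_ne_top]
    have hsh : MeasurableSet (shell (closure O) φᵢ k) :=
      (isClosed_shell isClosed_closure (cφ.mono hKΩ) k).measurableSet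
    rw [← Set.inter_eq_left.2 (show shell (closure O) φᵢ k ⊆ closure O from Set.sep_subset _ _),
      ← setLIntegral_indicator hsh]
    refine setLIntegral_mono' hKm fun x hx => ?_
    by_cases hxs : x ∈ shell (closure O) φᵢ k
    · rw [Set.indicator_of_mem hxs]
      have h1 : R₁ x ≤ M * B * D * (k * ‖oneJet w x‖ ^ 2) := by
        have h2 : deriv α (φᵢ x) ≤ B * k := by
          rw [hα, deriv_smoothTransition_comp_mul]
          exact mul_le_mul_of_nonneg_right (HB _) hk0
        calc R₁ x ≤ (B * k) * D * (M * ‖oneJet w x‖ ^ 2) :=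
              mul_le_mul_of_nonneg_right (mul_le_mul h2 (hγD x hx) (hγ0 _) (by positivity))
                (by positivity)
          _ = _ := by ring
      refine (ENNReal.ofReal_le_ofReal h1).trans (le_of_eq ?_)
      rw [ENNReal.ofReal_mul (by positivity), ENNReal.ofReal_mul hk0, ENNReal.ofReal_natCast,
        ENNReal.ofReal_pow (norm_nonneg _), ofReal_norm, ENNReal.coe_pow]
      rfl
    · have h1 : R₁ x = 0 := by
        have h2 : 1 < k * φᵢ x := not_le.1 fun h2 => hxs ⟨hx, hO.initial_nonneg hx, h2⟩
        simp only [R₁]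
        rw [hα, deriv_smoothTransition_comp_mul, deriv_smoothTransition_of_one_lt h2]
        ring
      simp [h1]
  have hi₂ : ∫⁻ x in closure O, ENNReal.ofReal (R₂ x) ≤ ENNReal.ofReal (M * D)
      * ∫⁻ x in O ∩ {x | t x ≤ s}, ENNReal.ofReal (secondOrderOp h b c w x ^ 2) := by
    rw [← lintegral_const_mul' _ _ ENNReal.ofReal_ne_top,
      ← Set.inter_eq_left.2 (Set.inter_subset_left.trans subset_closure :
        O ∩ {x | t x ≤ s} ⊆ closure O), ← setLIntegral_indicator cOm]
    refine setLIntegral_mono' hKm fun x hx => ?_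
    by_cases hxs : x ∈ O ∩ {x | t x ≤ s}
    · rw [Set.indicator_of_mem hxs, ← ENNReal.ofReal_mul (by positivity)]
      refine ENNReal.ofReal_le_ofReal ?_
      have h1 : α (φᵢ x) * β (φₑ x) ≤ 1 := mul_le_one₀ (hα1 _) (hβ0 _) (hβ1 _)
      calc R₂ x ≤ 1 * D * (M * secondOrderOp h b c w x ^ 2) :=
            mul_le_mul_of_nonneg_right (mul_le_mul h1 (hγD x hx) (hγ0 _) zero_le_one)
              (by positivity)
        _ = _ := by ring
    · have h1 : R₂ x = 0 := by
        simp only [R₂]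
        by_cases hxO : x ∈ O
        · have h2 : s ≤ t x := (not_le.1 fun h2 => hxs ⟨hxO, h2⟩).le
          rw [show γ (t x) = 0 from timeWeight_eq_zero hk0 h2]
          ring
        · rw [hαβ x (hKΩ hx) hxO]
          ring
      simp [h1]
  calc ∫⁻ x in closure O, ENNReal.ofReal (q x)
      = ENNReal.ofReal (∫ x in closure O, q x) :=
        (ofReal_integral_eq_lintegral_ofReal (hint cq) (Eventually.of_forall hq0)).symm
    _ ≤ ENNReal.ofReal (∫ x in closure O, (R₁ x + R₂ x)) := ENNReal.ofReal_le_ofReal hreal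
    _ = ∫⁻ x in closure O, ENNReal.ofReal (R₁ x + R₂ x) :=
        ofReal_integral_eq_lintegral_ofReal (hint (cR₁.add cR₂))
          (Eventually.of_forall fun x => add_nonneg (hR₁0 x) (hR₂0 x))
    _ = (∫⁻ x in closure O, ENNReal.ofReal (R₁ x)) + ∫⁻ x in closure O, ENNReal.ofReal (R₂ x) := by
        rw [← lintegral_add_left' (hae cR₁)]
        exact lintegral_congr fun x => ENNReal.ofReal_add (hR₁0 x) (hR₂0 x)
    _ ≤ _ := add_le_add hi₁ hi₂

end EnergyEstimate

section MainEstimate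
variable {n : ℕ} {Ω O : Set (EuclideanSpace ℝ (Fin (n + 1)))}
  {h : EuclideanSpace ℝ (Fin (n + 1)) → Matrix (Fin (n + 1)) (Fin (n + 1)) ℝ}
  {b : EuclideanSpace ℝ (Fin (n + 1)) → Fin (n + 1) → ℝ}
  {c φᵢ φₑ t w : EuclideanSpace ℝ (Fin (n + 1)) → ℝ} {s₀ s₁ : ℝ}

theorem sq_le_norm_oneJet_sq {d : ℕ} (w : EuclideanSpace ℝ (Fin d) → ℝ)
    (x : EuclideanSpace ℝ (Fin d)) : w x ^ 2 ≤ ‖oneJet w x‖ ^ 2 := by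
  rw [← sq_abs (w x)]
  gcongr
  exact norm_fst_le (oneJet w x)

theorem norm_oneJet_sq_le {d : ℕ} (w : EuclideanSpace ℝ (Fin d) → ℝ)
    (x : EuclideanSpace ℝ (Fin d)) : ‖oneJet w x‖ ^ 2 ≤ w x ^ 2 + ‖fderiv ℝ w x‖ ^ 2 := by
  have h1 : ‖partialDerivs w x‖ ≤ ‖fderiv ℝ w x‖ := by
    refine (pi_norm_le_iff_of_nonneg (norm_nonneg _)).2 fun i => ?_
    refine ((fderiv ℝ w x).le_opNorm _).trans ?_
    simp
  have h2 : ‖oneJet w x‖ = max |w x| ‖partialDerivs w x‖ := rfl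
  rw [h2]
  rcases max_choice |w x| ‖partialDerivs w x‖ with h | h <;> rw [h]
  · rw [sq_abs]; nlinarith [sq_nonneg ‖fderiv ℝ w x‖]
  · nlinarith [sq_nonneg (w x), norm_nonneg (partialDerivs w x)]

theorem setLIntegral_norm_oneJet_le (hΩ : IsOpen Ω)
    (hh : ∀ i j, ContDiffOn ℝ 1 (fun x => h x i j) Ω)
    (hb : ∀ j, ContinuousOn (fun x => b x j) Ω) (hc : ContinuousOn c Ω)
    (hsig : ∀ x ∈ Ω, HasLorentzSignature (h x))
    (hO : IsSpacelikeSweptRegion h Ω O φᵢ φₑ t s₀ s₁) :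
    ∃ A B D : ℝ, 0 < A ∧ 0 ≤ B ∧ 0 ≤ D ∧ ∀ w, ContDiffOn ℝ 2 w Ω → ∀ s ∈ Set.Icc s₀ s₁,
      ENNReal.ofReal A * ∫⁻ x in O ∩ {x | t x < s}, ENNReal.ofReal (‖oneJet w x‖ ^ 2)
        ≤ ENNReal.ofReal (B * (s - s₀)) * (∫⁻ x in levelSurface O φᵢ 0,
            ((‖oneJet w x‖₊ ^ 2 : ℝ≥0) : ℝ≥0∞) ∂μHE[n])
          + ENNReal.ofReal (D * (s - s₀))
            * ∫⁻ x in O ∩ {x | t x ≤ s}, ENNReal.ofReal (secondOrderOp h b c w x ^ 2) := by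
  obtain ⟨c₀, M, hc₀, hM, H0, H1, H2, k₀, Hk⟩ := exists_energy_constants hΩ hh hb hc hsig hO
  obtain ⟨B, hB, HB⟩ := exists_deriv_smoothTransition_le
  have hK := hO.isCompact_closure
  have hKΩ := hO.closure_subset
  obtain ⟨C, hC⟩ := exists_limsup_lintegral_shell_le hK (φ := φᵢ)
    (fun x hx => (hO.contDiffOn_initial.contDiffAt (hΩ.mem_nhds (hKΩ hx))).of_le one_le_two)
    (fun x hx h0 => IsSpacelikeSweptRegion.fderiv_ne_zero_of_timelike
      (hO.spacelike_initial x ⟨hx, h0⟩).1)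
  set e := Real.exp (-(M / c₀) * s₀)
  have he : 0 < e := Real.exp_pos _
  refine ⟨c₀ * Real.exp (-(M / c₀) * s₁), M * B * e * C, M * e, by positivity, by positivity,
    by positivity, fun w hw s hs => ?_⟩
  set A := c₀ * Real.exp (-(M / c₀) * s₁)
  have hA : 0 < A := by positivity
  have hs0 : 0 ≤ s - s₀ := sub_nonneg.2 hs.1
  set q : ℕ → EuclideanSpace ℝ (Fin (n + 1)) → ℝ := fun k x => A
        * (Real.smoothTransition (k * φᵢ x) * Real.smoothTransition (-k * φₑ x)
          * Real.smoothTransition (k * (s - t x)) * ‖oneJet w x‖ ^ 2)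
  set S : ℕ → ℝ≥0∞ := fun k =>
    ∫⁻ x in shell (closure O) φᵢ k, (k : ℝ≥0∞) * (‖oneJet w x‖₊ ^ 2 : ℝ≥0)
  set P := ENNReal.ofReal (M * ((s - s₀) * e))
    * ∫⁻ x in O ∩ {x | t x ≤ s}, ENNReal.ofReal (secondOrderOp h b c w x ^ 2) with hP
  have cz := continuousOn_oneJet hΩ (hw.of_le one_le_two)
  have cq : ∀ k, ContinuousOn (q k) Ω := fun k => by
    have hT := fun a : ℝ => Real.smoothTransition.continuous.comp (continuous_const_mul a)
    exact continuousOn_const.mul (((((hT k).comp_continuousOn hO.contDiffOn_initial.continuousOn).mul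
      ((hT (-k)).comp_continuousOn hO.contDiffOn_final.continuousOn)).mul
      ((hT k).comp_continuousOn (continuousOn_const.sub hO.contDiffOn_time.continuousOn))).mul
      (cz.norm.pow 2))
  have hstep : ∀ k, k₀ ≤ k → ∫⁻ x in closure O, ENNReal.ofReal (q k x)
      ≤ ENNReal.ofReal (M * B * ((s - s₀) * e)) * S k + P := fun k hk =>
    weighted_energy_le hΩ hh hb hc hsig hO hc₀ hM hB H0 H1 H2 HB (Hk k hk) hw hs
  have hlim : ∀ x ∈ O ∩ {x | t x < s},
      ENNReal.ofReal A * ENNReal.ofReal (‖oneJet w x‖ ^ 2)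
        ≤ liminf (fun k => ENNReal.ofReal (q k x)) atTop := by
    rintro x ⟨hxO, hxs⟩
    rw [hO.between] at hxO
    have hev : ∀ {a : ℝ}, 0 < a → ∀ᶠ k : ℕ in atTop, Real.smoothTransition (k * a) = 1 := by
      intro a ha
      filter_upwards [(tendsto_natCast_atTop_atTop.atTop_mul_const ha).eventually_ge_atTop 1]
        with k hk using Real.smoothTransition.one_of_one_le hk
    refine le_liminf_of_le (by isBoundedDefault) ?_
    filter_upwards [hev hxO.2.1, hev (neg_pos.2 hxO.2.2), hev (sub_pos.2 hxs)] with k h1 h2 h3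
    rw [← ENNReal.ofReal_mul hA.le]
    refine ENNReal.ofReal_le_ofReal (le_of_eq ?_)
    simp only [q]
    rw [h1, h3, neg_mul, ← mul_neg, h2]
    ring
  have hOm : MeasurableSet (O ∩ {x | t x < s}) := by
    have h1 : O ∩ {x | t x < s} = O ∩ (Ω ∩ t ⁻¹' Set.Iio s) := by
      ext x
      exact ⟨fun hx => ⟨hx.1, hKΩ (subset_closure hx.1), hx.2⟩, fun hx => ⟨hx.1, hx.2.2⟩⟩
    rw [h1]
    exact ((hO.isOpen hΩ).inter
      (hO.contDiffOn_time.continuousOn.isOpen_inter_preimage hΩ isOpen_Iio)).measurableSet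
  calc ENNReal.ofReal A * ∫⁻ x in O ∩ {x | t x < s}, ENNReal.ofReal (‖oneJet w x‖ ^ 2)
      = ∫⁻ x in O ∩ {x | t x < s}, ENNReal.ofReal A * ENNReal.ofReal (‖oneJet w x‖ ^ 2) :=
        (lintegral_const_mul' _ _ ENNReal.ofReal_ne_top).symm
    _ ≤ ∫⁻ x in O ∩ {x | t x < s}, liminf (fun k => ENNReal.ofReal (q k x)) atTop :=
        setLIntegral_mono' hOm hlim
    _ ≤ ∫⁻ x in closure O, liminf (fun k => ENNReal.ofReal (q k x)) atTop :=
        lintegral_mono_set (Set.inter_subset_left.trans subset_closure)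
    _ ≤ liminf (fun k => ∫⁻ x in closure O, ENNReal.ofReal (q k x)) atTop :=
        lintegral_liminf_le' fun k => (((cq k).mono hKΩ).aemeasurable
          isClosed_closure.measurableSet).ennreal_ofReal
    _ ≤ limsup (fun k => ∫⁻ x in closure O, ENNReal.ofReal (q k x)) atTop := liminf_le_limsup
    _ ≤ limsup ((fun k => ENNReal.ofReal (M * B * ((s - s₀) * e)) * S k) + fun _ => P) atTop :=
        limsup_le_limsup ((eventually_ge_atTop k₀).mono hstep)
    _ ≤ limsup (fun k => ENNReal.ofReal (M * B * ((s - s₀) * e)) * S k) atTop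
          + limsup (fun _ : ℕ => P) atTop := ennreal_limsup_add_le _ _ _
    _ = ENNReal.ofReal (M * B * ((s - s₀) * e)) * limsup S atTop + P := by
        rw [ENNReal.limsup_const_mul_of_ne_top ENNReal.ofReal_ne_top, limsup_const]
    _ ≤ ENNReal.ofReal (M * B * ((s - s₀) * e)) * (C * ∫⁻ x in levelSurface O φᵢ 0,
          ((‖oneJet w x‖₊ ^ 2 : ℝ≥0) : ℝ≥0∞) ∂μHE[n]) + P := by
        gcongr
        exact hC (fun x => ‖oneJet w x‖₊ ^ 2) ((cz.mono hKΩ).nnnorm.pow 2)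
    _ = _ := by
        rw [← mul_assoc, hP, ← ENNReal.ofReal_coe_nnreal, ← ENNReal.ofReal_mul (by positivity)]
        congr 3 <;> ring_nf

/-- The energy estimate for the operator `L`, without densities. -/
theorem exists_energy_estimate (hΩ : IsOpen Ω) (hh : ∀ i j, ContDiffOn ℝ 1 (fun x => h x i j) Ω)
    (hb : ∀ j, ContinuousOn (fun x => b x j) Ω) (hc : ContinuousOn c Ω)
    (hsig : ∀ x ∈ Ω, HasLorentzSignature (h x))
    (hO : IsSpacelikeSweptRegion h Ω O φᵢ φₑ t s₀ s₁) :
    ∃ B D : ℝ, 0 ≤ B ∧ 0 ≤ D ∧ ∀ w, ContDiffOn ℝ 2 w Ω → ∀ s ∈ Set.Icc s₀ s₁,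
      ∫⁻ x in sweptRegion O t s, ENNReal.ofReal (w x ^ 2)
        ≤ ENNReal.ofReal (B * (s - s₀)) * (∫⁻ x in levelSurface O φᵢ 0,
            ENNReal.ofReal (w x ^ 2 + ‖fderiv ℝ w x‖ ^ 2) ∂μHE[n])
          + ENNReal.ofReal (D * (s - s₀))
            * ∫⁻ x in O ∩ {x | t x ≤ s}, ENNReal.ofReal (secondOrderOp h b c w x ^ 2) := by
  obtain ⟨A, B, D, hA, hB, hD, H⟩ := setLIntegral_norm_oneJet_le hΩ hh hb hc hsig hO
  refine ⟨A⁻¹ * B, A⁻¹ * D, by positivity, by positivity, fun w hw s hs => ?_⟩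
  have h1 : ∫⁻ x in sweptRegion O t s, ENNReal.ofReal (w x ^ 2)
      ≤ ∫⁻ x in O ∩ {x | t x < s}, ENNReal.ofReal (‖oneJet w x‖ ^ 2) := by
    calc ∫⁻ x in sweptRegion O t s, ENNReal.ofReal (w x ^ 2)
        ≤ ∫⁻ x in sweptRegion O t s, ENNReal.ofReal (‖oneJet w x‖ ^ 2) :=
          lintegral_mono fun x => ENNReal.ofReal_le_ofReal (sq_le_norm_oneJet_sq w x)
      _ ≤ ∫⁻ x in (O ∩ {x | t x < s}) ∪ (sweptRegion O t s \ (O ∩ {x | t x < s})),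
            ENNReal.ofReal (‖oneJet w x‖ ^ 2) :=
          lintegral_mono_set (by rw [Set.union_sdiff_self]; exact Set.subset_union_right)
      _ ≤ _ := lintegral_union_le _ _ _
      _ = _ := by rw [setLIntegral_measure_zero _ _ (hO.volume_closure_diff hΩ s), add_zero]
  have h2 : ∫⁻ x in levelSurface O φᵢ 0, ((‖oneJet w x‖₊ ^ 2 : ℝ≥0) : ℝ≥0∞) ∂μHE[n]
      ≤ ∫⁻ x in levelSurface O φᵢ 0, ENNReal.ofReal (w x ^ 2 + ‖fderiv ℝ w x‖ ^ 2) ∂μHE[n] := by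
    refine lintegral_mono fun x => ?_
    rw [← ENNReal.ofReal_coe_nnreal]
    exact ENNReal.ofReal_le_ofReal (norm_oneJet_sq_le w x)
  have hAA : ENNReal.ofReal A⁻¹ * ENNReal.ofReal A = 1 := by
    rw [← ENNReal.ofReal_mul (by positivity), inv_mul_cancel₀ hA.ne', ENNReal.ofReal_one]
  calc ∫⁻ x in sweptRegion O t s, ENNReal.ofReal (w x ^ 2)
      ≤ ENNReal.ofReal A⁻¹ * (ENNReal.ofReal A
          * ∫⁻ x in O ∩ {x | t x < s}, ENNReal.ofReal (‖oneJet w x‖ ^ 2)) := by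
        rwa [← mul_assoc, hAA, one_mul]
    _ ≤ ENNReal.ofReal A⁻¹ * _ := mul_le_mul_right ((H w hw s hs).trans
        (add_le_add_left (mul_le_mul_right h2 _) _)) _
    _ = _ := by
        rw [mul_add, ← mul_assoc, ← mul_assoc, ← ENNReal.ofReal_mul (by positivity),
          ← ENNReal.ofReal_mul (by positivity), mul_assoc, mul_assoc]

theorem exists_pos_forall_le {X : Type*} [TopologicalSpace X] {K : Set X} (hK : IsCompact K)
    {f : X → ℝ} (hf : ContinuousOn f K) (hpos : ∀ x ∈ K, 0 < f x) :
    ∃ m : ℝ, 0 < m ∧ ∀ x ∈ K, m ≤ f x := by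
  rcases K.eq_empty_or_nonempty with rfl | hne
  · exact ⟨1, one_pos, by simp⟩
  · obtain ⟨y, hy, hmin⟩ := hK.exists_isMinOn hne hf
    exact ⟨f y, hpos y hy, fun x hx => hmin hx⟩

theorem contDiff_polyFun {d : ℕ} {m : WithTop ℕ∞} (p : MvPolynomial (Fin d) ℝ) :
    ContDiff ℝ m (polyFun p) := by
  induction p using MvPolynomial.induction_on with
  | C a =>
    have : polyFun (MvPolynomial.C a : MvPolynomial (Fin d) ℝ) = fun _ => a := by
      ext; simp [polyFun]
    rw [this]
    exact contDiff_const
  | add p q hp hq =>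
    have : polyFun (p + q) = fun x => polyFun p x + polyFun q x := by ext; simp [polyFun]
    rw [this]
    exact hp.add hq
  | mul_X p i hp =>
    have : polyFun (p * MvPolynomial.X i) = fun x => polyFun p x * x i := by ext; simp [polyFun]
    rw [this]
    exact hp.mul (by fun_prop)

end MainEstimate

theorem mainTheorem2 {n : ℕ} (Ω O : Set (EuclideanSpace ℝ (Fin (n + 1)))) (hΩ : IsOpen Ω)
    (h : EuclideanSpace ℝ (Fin (n + 1)) → Matrix (Fin (n + 1)) (Fin (n + 1)) ℝ)
    (b : EuclideanSpace ℝ (Fin (n + 1)) → Fin (n + 1) → ℝ)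
    (c : EuclideanSpace ℝ (Fin (n + 1)) → ℝ)
    (hh : ∀ i j, ContDiffOn ℝ 1 (fun x => h x i j) Ω)
    (hb : ∀ j, ContinuousOn (fun x => b x j) Ω) (hc : ContinuousOn c Ω)
    (hsig : ∀ x ∈ Ω, HasLorentzSignature (h x))
    (φᵢ φₑ t : EuclideanSpace ℝ (Fin (n + 1)) → ℝ) (s₀ s₁ : ℝ)
    (hO : IsSpacelikeSweptRegion h Ω O φᵢ φₑ t s₀ s₁)
    -- the densities of `dV = ρ dx` and `dS = σ dℋⁿ`
    (ρ σ : EuclideanSpace ℝ (Fin (n + 1)) → ℝ)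
    (hρ : ContinuousOn ρ Ω) (hρ_pos : ∀ x ∈ Ω, 0 < ρ x)
    (hσ : ContinuousOn σ (levelSurface O φᵢ 0)) (hσ_pos : ∀ x ∈ levelSurface O φᵢ 0, 0 < σ x) :
    ∃ C : ℝ, 0 ≤ C ∧
      ∀ (u f g : EuclideanSpace ℝ (Fin (n + 1)) → ℝ)
        (ω : EuclideanSpace ℝ (Fin (n + 1)) → EuclideanSpace ℝ (Fin (n + 1)) →L[ℝ] ℝ)
        (Θ Θb : Finset (EuclideanSpace ℝ (Fin (n + 1)))) (p : MvPolynomial (Fin (n + 1)) ℝ)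
        (Δf Δg : EuclideanSpace ℝ (Fin (n + 1)) → ℝ)
        (Δω : EuclideanSpace ℝ (Fin (n + 1)) → EuclideanSpace ℝ (Fin (n + 1)) →L[ℝ] ℝ),
        ContDiffOn ℝ 2 u Ω →
        SolvesCauchyProblem h b c O (levelSurface O φᵢ 0) f g ω u →
        IsInterpolationPolynomial h b c O (levelSurface O φᵢ 0) f g ω Θ Θb p →
        SolvesCauchyProblem h b c O (levelSurface O φᵢ 0) Δf Δg Δω (fun x => u x - polyFun p x) →
        ∀ s ∈ Set.Icc s₀ s₁,
          ∫⁻ x in sweptRegion O t s, ENNReal.ofReal (|u x - polyFun p x| ^ 2 * ρ x)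
            ≤ ∫⁻ x in levelSurface O φᵢ 0 ∩ {x | t x ≤ s},
                  ENNReal.ofReal (|Δg x| ^ 2 * σ x) ∂μHE[n]
              + ENNReal.ofReal (C * (s - s₀)) * ∫⁻ x in levelSurface O φᵢ 0,
                  ENNReal.ofReal ((|Δg x| ^ 2 + ‖Δω x‖ ^ 2) * σ x) ∂μHE[n]
              + ENNReal.ofReal C * ∫⁻ x in sweptRegion O t s,
                  ENNReal.ofReal (|Δf x| ^ 2 * ρ x) := by
  have hKΩ := hO.closure_subset
  obtain ⟨B, D, hB, hD, H⟩ := exists_energy_estimate hΩ hh hb hc hsig hO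
  obtain ⟨R, hR⟩ := hO.isCompact_closure.bddAbove_image (hρ.mono hKΩ)
  obtain ⟨r, hr, hrρ⟩ := exists_pos_forall_le hO.isCompact_closure (hρ.mono hKΩ)
    fun x hx => hρ_pos x (hKΩ hx)
  obtain ⟨m, hm, hmσ⟩ := exists_pos_forall_le hO.isCompact_initial hσ hσ_pos
  set C₁ := |R| * B * m⁻¹ with hC₁
  set C₂ := |R| * D * |s₁ - s₀| * r⁻¹ with hC₂
  have hC₁0 : 0 ≤ C₁ := by positivity
  have hC₂0 : 0 ≤ C₂ := by positivity
  refine ⟨C₁ + C₂, by positivity, fun u f g ω Θ Θb p Δf Δg Δω hu _ _ hΔ s hs => ?_⟩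
  have hs0 : 0 ≤ s - s₀ := sub_nonneg.2 hs.1
  set w : EuclideanSpace ℝ (Fin (n + 1)) → ℝ := fun x => u x - polyFun p x with hwdef
  have hw : ContDiffOn ℝ 2 w Ω := hu.sub (contDiff_polyFun p).contDiffOn
  have h1 : ∫⁻ x in sweptRegion O t s, ENNReal.ofReal (|w x| ^ 2 * ρ x)
      ≤ ENNReal.ofReal |R| * ∫⁻ x in sweptRegion O t s, ENNReal.ofReal (w x ^ 2) := by
    rw [← lintegral_const_mul' _ _ ENNReal.ofReal_ne_top]
    refine setLIntegral_mono' (hO.isClosed_sweptRegion s).measurableSet fun x hx => ?_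
    rw [← ENNReal.ofReal_mul (abs_nonneg R), sq_abs, mul_comm]
    exact ENNReal.ofReal_le_ofReal (mul_le_mul_of_nonneg_right
      ((hR ⟨x, hx.1, rfl⟩).trans (le_abs_self R)) (sq_nonneg _))
  have h2 : ∫⁻ x in levelSurface O φᵢ 0, ENNReal.ofReal (w x ^ 2 + ‖fderiv ℝ w x‖ ^ 2) ∂μHE[n]
      ≤ ENNReal.ofReal m⁻¹ * ∫⁻ x in levelSurface O φᵢ 0,
          ENNReal.ofReal ((|Δg x| ^ 2 + ‖Δω x‖ ^ 2) * σ x) ∂μHE[n] := by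
    rw [← lintegral_const_mul' _ _ ENNReal.ofReal_ne_top]
    refine setLIntegral_mono' hO.isCompact_initial.measurableSet fun x hx => ?_
    rw [← ENNReal.ofReal_mul (by positivity), hΔ.value x hx, hΔ.differential x hx, sq_abs,
      inv_mul_eq_div]
    refine ENNReal.ofReal_le_ofReal ((le_div_iff₀ hm).2 ?_)
    exact mul_le_mul_of_nonneg_left (hmσ x hx) (by positivity)
  have h3 : ∫⁻ x in O ∩ {x | t x ≤ s}, ENNReal.ofReal (secondOrderOp h b c w x ^ 2)
      ≤ ENNReal.ofReal r⁻¹ * ∫⁻ x in sweptRegion O t s, ENNReal.ofReal (|Δf x| ^ 2 * ρ x) := by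
    rw [← lintegral_const_mul' _ _ ENNReal.ofReal_ne_top]
    refine (setLIntegral_mono' (hO.measurableSet_inter_le hΩ s) fun x hx => ?_).trans
      (lintegral_mono_set fun x hx => ⟨subset_closure hx.1, hx.2⟩)
    rw [← ENNReal.ofReal_mul (by positivity), hΔ.equation x hx.1, sq_abs, inv_mul_eq_div]
    refine ENNReal.ofReal_le_ofReal ((le_div_iff₀ hr).2 ?_)
    exact mul_le_mul_of_nonneg_left (hrρ x (subset_closure hx.1)) (by positivity)
  set I₁ := ∫⁻ x in levelSurface O φᵢ 0, ENNReal.ofReal ((|Δg x| ^ 2 + ‖Δω x‖ ^ 2) * σ x) ∂μHE[n]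
  set I₂ := ∫⁻ x in sweptRegion O t s, ENNReal.ofReal (|Δf x| ^ 2 * ρ x)
  calc ∫⁻ x in sweptRegion O t s, ENNReal.ofReal (|w x| ^ 2 * ρ x)
      ≤ ENNReal.ofReal |R| * (ENNReal.ofReal (B * (s - s₀)) * (ENNReal.ofReal m⁻¹ * I₁)
          + ENNReal.ofReal (D * (s - s₀)) * (ENNReal.ofReal r⁻¹ * I₂)) :=
        h1.trans (mul_le_mul_right ((H w hw s hs).trans
          (add_le_add (mul_le_mul_right h2 _) (mul_le_mul_right h3 _))) _)
    _ = ENNReal.ofReal (C₁ * (s - s₀)) * I₁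
          + ENNReal.ofReal (|R| * D * (s - s₀) * r⁻¹) * I₂ := by
        rw [mul_add, ← mul_assoc, ← mul_assoc, ← mul_assoc, ← mul_assoc,
          ← ENNReal.ofReal_mul (by positivity), ← ENNReal.ofReal_mul (by positivity),
          ← ENNReal.ofReal_mul (by positivity), ← ENNReal.ofReal_mul (by positivity)]
        rw [show |R| * (B * (s - s₀)) * m⁻¹ = C₁ * (s - s₀) by rw [hC₁]; ring,
          ← mul_assoc |R| D]
    _ ≤ ENNReal.ofReal ((C₁ + C₂) * (s - s₀)) * I₁ + ENNReal.ofReal (C₁ + C₂) * I₂ := by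
        gcongr
        · linarith
        · have h4 : s - s₀ ≤ |s₁ - s₀| := le_trans (by linarith [hs.2]) (le_abs_self _)
          have h5 : |R| * D * (s - s₀) * r⁻¹ ≤ C₂ := by rw [hC₂]; gcongr
          linarith
    _ ≤ _ := by
        rw [add_assoc]
        exact le_add_self
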